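/- \textbf{Definitions.} Let $M$ be a smooth manifold of dimension $n(k+1)$. A \emph{$k$-symplectic structure} on $M$ consists of closed smooth $2$-forms $\omega_1,\dots,\omega_k$ and an $nk$-dimensional foliation $\mathcal F$ with tangent bundle $L$ such that $C_x(\omega_1)\cap\dots\cap C_x(\omega_k)=\{0\}$ for every $x\in M$, where $C_x(\omega)=\{v\in T_xM:\omega_x(v,w)=0\ \text{for all } w\in T_xM\}$, and $\omega_\alpha(X,X')=0$ for all $X,X'\in\Gamma(L)$ and all $\alpha$. Put $L_\alpha=L\cap\bigcap_{\beta\ne\alpha}C(\omega_\beta)$ (for $k\ge 2$ this equals $\bigcap_{\beta\neq\alpha}C(\omega_\beta)$; for $k=1$ it is $L$). Let $Q$ be an $n$-dimensional integrable smooth distribution with $TM=L\oplus Q$ such that (i) $\omega_\alpha(Y,Y')=0$ for all $Y,Y'\in\Gamma(Q)$ and all $\alpha$; (ii) $[X,Y]\in\Gamma(L_\alpha\oplus Q)$ for all $X\in\Gamma(L_\alpha)$, $Y\in\Gamma(Q)$ and all $\alpha$; (iii) for all $Y,Y'\in\Gamma(Q)$ there is $Z\in\Gamma(Q)$ such that,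 for every $\alpha$ and every $X\in\Gamma(L_\alpha)$, $\omega_\alpha(Z,X)=Y(\omega_\alpha(Y',X))-\omega_\alpha(Y',[Y,X])$. The \emph{canonical connection} attached to these data is the linear connection $\nabla$ on $M$ such that $\nabla L_\alpha\subset L_\alpha$ for each $\alpha$, $\nabla Q\subset Q$, $\nabla\omega_1=\dots=\nabla\omega_k=0$, and whose torsion satisfies $T(X,Y)=0$ for all $X\in\Gamma(L)$, $Y\in\Gamma(Q)$. \textbf{Theorem.} Suppose that the canonical connection $\nabla$ is flat, i.e.\ its curvature vanishes identically. Then around each point of $M$ there are local coordinates $(x_1,\dots,x_n,y_1,\dots,y_{kn})$ in which $$\omega_\alpha=\sum_{i=1}^n dx_i\wedge dy_{(\alpha-1)n+i}\qquad(\alpha=1,\dots,k),$$ $\mathcal F$ is described by the equations $x_1=\text{const},\dots,x_n=\text{const}$ (that is, on the coordinate domain $U$, $L$ is the common kernel of $dx_1,\dots,dx_n$ and the leaves of $\mathcal F|_U$ are the level sets of $(x_1,\dots,x_n)$), and $Q$ is spanned by $\partial/\partial x_1,\dots,\partial/\partial x_n$. -/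

import Mathlib

open Set VectorField
open scoped Manifold ContDiff Topology

noncomputable section

namespace KSymplectic

section General

variable {E : Type*} [NormedAddCommGroup E] [NormedSpace ℝ E]
  {H : Type*} [TopologicalSpace H] (I : ModelWithCorners ℝ E H)
  {M : Type*} [TopologicalSpace M] [ChartedSpace H M]

/-! ### Vector fields, distributions, foliations -/

/-- Vector fields on `M` (no regularity required). -/
abbrev VField (M : Type*) [TopologicalSpace M] [ChartedSpace H M] : Type _ :=
  (x : M) → TangentSpace I x

/-- Distributions on `M`: a linear subspace of each tangent space (no regularity required). -/
abbrev Distribution (M : Type*) [TopologicalSpace M] [ChartedSpace H M] : Type _ :=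
  (x : M) → Submodule ℝ (TangentSpace I x)

/-- Bilinear forms on the tangent spaces of `M` (no regularity required). -/
abbrev BilinForm (M : Type*) [TopologicalSpace M] [ChartedSpace H M] : Type _ :=
  (x : M) → TangentSpace I x →L[ℝ] TangentSpace I x →L[ℝ] ℝ

variable {I}

/-- `X` is smooth on the set `U`. -/
def SmoothFieldOn [IsManifold I ∞ M] (X : VField I M) (U : Set M) : Prop :=
  ContMDiffOn I I.tangent ∞ (fun x => (Bundle.TotalSpace.mk' E x (X x) : TangentBundle I M)) U

/-- `X ∈ Γ(TM)`: `X` is a smooth vector field on `M`. -/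
def SmoothField [IsManifold I ∞ M] (X : VField I M) : Prop := SmoothFieldOn X univ

/-- `X ∈ Γ(D)`: `X` is a smooth vector field on `M` with values in the distribution `D`. -/
def IsSection [IsManifold I ∞ M] (D : Distribution I M) (X : VField I M) : Prop :=
  SmoothField X ∧ ∀ x, X x ∈ D x

/-- `D` is a smooth distribution of rank `r` (a smooth subbundle of `TM`): near every point it is
spanned by `r` smooth pointwise linearly independent vector fields. -/
def IsSmoothDistribution [IsManifold I ∞ M] (D : Distribution I M) (r : ℕ) : Prop :=
  ∀ p : M, ∃ U : Set M, IsOpen U ∧ p ∈ U ∧ ∃ s : Fin r → VField I M,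
    (∀ i, SmoothFieldOn (s i) U) ∧
    ∀ x ∈ U, LinearIndependent ℝ (fun i => s i x) ∧
      Submodule.span ℝ (Set.range fun i => s i x) = D x

/-- `D` is an integrable smooth distribution of rank `r`, that is, the tangent bundle of an
`r`-dimensional foliation: a smooth distribution of rank `r` whose sections are closed under the
Lie bracket. -/
structure IsFoliation [IsManifold I ∞ M] (D : Distribution I M) (r : ℕ) : Prop where
  smooth : IsSmoothDistribution D r
  involutive : ∀ X Y : VField I M, IsSection D X → IsSection D Y →
    ∀ x, mlieBracket I X Y x ∈ D x

/-- The points `a`, `b` lie on the same leaf of the restriction to `U` of the foliation tangent to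
`D`: they are joined by a smooth curve inside `U` that is everywhere tangent to `D`. -/
def SameLeafIn (D : Distribution I M) (U : Set M) (a b : M) : Prop :=
  ∃ γ : ℝ → M, ContMDiffOn 𝓘(ℝ, ℝ) I ∞ γ (Icc 0 1) ∧ γ 0 = a ∧ γ 1 = b ∧
    ∀ t ∈ Icc (0 : ℝ) 1, γ t ∈ U ∧
      (mfderivWithin 𝓘(ℝ, ℝ) I γ (Icc 0 1) t (1 : ℝ) : TangentSpace I (γ t)) ∈ D (γ t)

/-! ### Differential forms of degree two -/

/-- The derivative `X f` of the function `f` along the vector field `X`. -/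
def dirDeriv (X : VField I M) (f : M → ℝ) (x : M) : ℝ := mvfderiv I f x (X x)

/-- The function `Ω(X, Y)`. -/
def evalForm (Ω : BilinForm I M) (X Y : VField I M) (x : M) : ℝ := Ω x (X x) (Y x)

/-- `Ω` is a smooth differential `2`-form. -/
structure IsTwoForm [IsManifold I ∞ M] (Ω : BilinForm I M) : Prop where
  alternating : ∀ x v, Ω x v v = 0
  smooth : ContMDiff I (I.prod 𝓘(ℝ, E →L[ℝ] E →L[ℝ] ℝ)) ∞
    (fun x => (Bundle.TotalSpace.mk' (E →L[ℝ] E →L[ℝ] ℝ) x (Ω x) :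
      Bundle.TotalSpace (E →L[ℝ] E →L[ℝ] ℝ)
        (fun x : M => TangentSpace I x →L[ℝ] TangentSpace I x →L[ℝ] ℝ)))

/-- The exterior derivative of a `2`-form, evaluated on three vector fields. -/
def extDerivTwo (Ω : BilinForm I M) (X Y Z : VField I M) (x : M) : ℝ :=
  dirDeriv X (evalForm Ω Y Z) x - dirDeriv Y (evalForm Ω X Z) x + dirDeriv Z (evalForm Ω X Y) x
    - Ω x (mlieBracket I X Y x) (Z x) + Ω x (mlieBracket I X Z x) (Y x)
    - Ω x (mlieBracket I Y Z x) (X x)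

/-- `dΩ = 0`. -/
def IsClosedForm [IsManifold I ∞ M] (Ω : BilinForm I M) : Prop :=
  ∀ X Y Z : VField I M, SmoothField X → SmoothField Y → SmoothField Z →
    ∀ x, extDerivTwo Ω X Y Z x = 0

/-- The kernel `C_x(Ω) = {v | Ω_x(v, w) = 0 for all w}`. -/
def charSpace (Ω : BilinForm I M) : Distribution I M := fun x => LinearMap.ker (Ω x).toLinearMap

/-- The exterior product `a ∧ b` of two covectors, evaluated on `u`, `v`. -/
def wedge {V : Type*} (a b : V → ℝ) (u v : V) : ℝ := a u * b v - a v * b u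

/-! ### `k`-symplectic structures -/

/-- `(Ω_1, …, Ω_k)` together with the `nk`-dimensional foliation `𝓕` tangent to `L` is a
`k`-symplectic structure on `M`. -/
structure IsKSymplectic [IsManifold I ∞ M] (n k : ℕ) (Ω : Fin k → BilinForm I M)
    (L : Distribution I M) : Prop where
  form : ∀ α, IsTwoForm (Ω α)
  closed : ∀ α, IsClosedForm (Ω α)
  foliation : IsFoliation L (n * k)
  nondegenerate : ∀ x, (⨅ α, charSpace (Ω α) x) = ⊥
  isotropic : ∀ α x, ∀ u ∈ L x, ∀ v ∈ L x, Ω α x u v = 0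

/-- The distribution `L_α = ⋂_{β ≠ α} C(Ω_β)`. The intersection with `L` changes nothing when there
are at least two forms (see `subBundle_eq_iInf`); for a single form it gives `L_1 = L`, as needed
for `L = L_1 ⊕ ⋯ ⊕ L_k`. -/
def subBundle {k : ℕ} (Ω : Fin k → BilinForm I M) (L : Distribution I M) (α : Fin k) :
    Distribution I M :=
  fun x => L x ⊓ ⨅ β, ⨅ _ : β ≠ α, charSpace (Ω β) x

/-- On a manifold of dimension `n(k+1)` with `k ≥ 2`, intersecting with `L` in the definition of `L_α`
is redundant. -/
theorem subBundle_eq_iInf {n k : ℕ} [FiniteDimensional ℝ E]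
    (hdim : Module.finrank ℝ E = n * (k + 1)) (hk : 2 ≤ k)
    {Ω : Fin k → BilinForm I M} {L : Distribution I M} (x : M)
    (halt : ∀ α v, Ω α x v v = 0) (hrank : Module.finrank ℝ (L x) = n * k)
    (hnd : (⨅ α, charSpace (Ω α) x) = ⊥)
    (hiso : ∀ α, ∀ u ∈ L x, ∀ v ∈ L x, Ω α x u v = 0) (α : Fin k) :
    subBundle Ω L α x = ⨅ β, ⨅ _ : β ≠ α, charSpace (Ω β) x := by
  have : FiniteDimensional ℝ (TangentSpace I x) := inferInstanceAs (FiniteDimensional ℝ E)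
  refine inf_eq_right.2 fun v hv => ?_
  obtain ⟨β, hβ⟩ : ∃ β : Fin k, β ≠ α := by
    have : Nontrivial (Fin k) := Fin.nontrivial_iff_two_le.2 hk
    exact exists_ne α
  simp only [Submodule.mem_iInf, charSpace, LinearMap.mem_ker] at hv
  -- the map `L → ∏ (TM / L)^*` given by the forms
  let F : L x →ₗ[ℝ] (Fin k → Module.Dual ℝ (TangentSpace I x ⧸ L x)) :=
    LinearMap.pi fun γ =>
      { toFun := fun l => (L x).liftQ (Ω γ x l).toLinearMap
          (fun w hw => hiso γ l l.2 w hw)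
        map_add' := fun a b => by ext w; simp; rfl
        map_smul' := fun a b => by ext w; simp; exact Or.inl rfl }
  have hF (l : L x) (γ : Fin k) (w : TangentSpace I x) :
      F l γ (Submodule.Quotient.mk w) = Ω γ x l w := rfl
  have hinj : Function.Injective F := by
    refine (injective_iff_map_eq_zero F).2 fun l hl => ?_
    have : (l : TangentSpace I x) ∈ (⨅ α, charSpace (Ω α) x) := by
      simp only [Submodule.mem_iInf, charSpace, LinearMap.mem_ker]
      intro γ
      ext w
      have := hF l γ w
      rw [hl] at this
      exact this.symm
    rw [hnd] at this
    exact Subtype.ext this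
  have hq : Module.finrank ℝ (TangentSpace I x ⧸ L x) = n := by
    have h1 := Submodule.finrank_quotient_add_finrank (L x)
    have h2 : Module.finrank ℝ (TangentSpace I x) = n * (k + 1) := hdim
    rw [h2, hrank, mul_add] at h1
    omega
  have hsurj : Function.Surjective F := by
    refine (LinearMap.injective_iff_surjective_of_finrank_eq_finrank ?_).1 hinj
    rw [hrank, Module.finrank_pi_fintype]
    simp [Subspace.dual_finrank_eq, hq, mul_comm]
  by_contra hvL
  have hv0 : (Submodule.Quotient.mk v : TangentSpace I x ⧸ L x) ≠ 0 := by
    rwa [Ne, Submodule.Quotient.mk_eq_zero]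
  have hne : ∃ f : Module.Dual ℝ (TangentSpace I x ⧸ L x), f (Submodule.Quotient.mk v) ≠ 0 := by
    by_contra! h
    exact hv0 ((Module.forall_dual_apply_eq_zero_iff ℝ _).1 h)
  obtain ⟨f, hf⟩ := hne
  obtain ⟨l, hl⟩ := hsurj (fun _ => f)
  apply hf
  have hadd := halt β ((l : TangentSpace I x) + v)
  have hvl : Ω β x v = 0 := hv β hβ
  have e : f (Submodule.Quotient.mk v) = Ω β x l v := by rw [← hF, hl]
  rw [e]
  simpa [hvl, halt β] using hadd

/-- The form `ψ^{YY'}(V) = (𝓛_Y i_{Y'} Ω)(V) = Y(Ω(Y', V)) - Ω(Y', [Y, V])`. -/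
def psi (Ω : BilinForm I M) (Y Y' V : VField I M) (x : M) : ℝ :=
  dirDeriv Y (evalForm Ω Y' V) x - Ω x (Y' x) (mlieBracket I Y V x)

/-- The hypotheses on the transversal distribution `Q` under which the canonical connection of a
`k`-symplectic manifold is defined. -/
structure IsAdmissible [IsManifold I ∞ M] (n : ℕ) {k : ℕ} (Ω : Fin k → BilinForm I M)
    (L Q : Distribution I M) : Prop where
  integrable : IsFoliation Q n
  transversal : ∀ x, IsCompl (L x) (Q x)
  isotropic : ∀ α x, ∀ u ∈ Q x, ∀ v ∈ Q x, Ω α x u v = 0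
  bracket : ∀ α (X Y : VField I M), IsSection (subBundle Ω L α) X → IsSection Q Y →
    ∀ x, mlieBracket I X Y x ∈ subBundle Ω L α x ⊔ Q x
  /-- The sections `(i_α^*)⁻¹(ψ_α^{YY'})` of `Q` coincide for all `α`, where
  `i_α^* : Q → L_α^*` is given by `i_α^*(Z)(X) = Ω_α(Z, X)`. -/
  psi_compat : ∀ Y Y' : VField I M, IsSection Q Y → IsSection Q Y' →
    ∃ Z : VField I M, IsSection Q Z ∧
      ∀ α (X : VField I M), IsSection (subBundle Ω L α) X →
        ∀ x, Ω α x (Z x) (X x) = psi (Ω α) Y Y' X x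

/-! ### Connections -/

/-- The field `∇_X Y`. -/
def nabla [IsManifold I ∞ M] (cov : CovariantDerivative I E (TangentSpace I : M → Type _))
    (X Y : VField I M) : VField I M :=
  fun x => cov Y x (X x)

/-- The curvature `R(X, Y) Z = ∇_X ∇_Y Z - ∇_Y ∇_X Z - ∇_{[X, Y]} Z`. -/
def curvature [IsManifold I ∞ M] (cov : CovariantDerivative I E (TangentSpace I : M → Type _))
    (X Y Z : VField I M) : VField I M :=
  nabla cov X (nabla cov Y Z) - nabla cov Y (nabla cov X Z) - nabla cov (mlieBracket I X Y) Z

/-- `∇` is flat: its curvature vanishes identically. -/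
def IsFlat [IsManifold I ∞ M] (cov : CovariantDerivative I E (TangentSpace I : M → Type _)) :
    Prop :=
  ∀ X Y Z : VField I M, SmoothField X → SmoothField Y → SmoothField Z →
    ∀ x, curvature cov X Y Z x = 0

/-- `∇ D ⊂ D`. -/
def Preserves [IsManifold I ∞ M] (cov : CovariantDerivative I E (TangentSpace I : M → Type _))
    (D : Distribution I M) : Prop :=
  ∀ V X : VField I M, SmoothField V → IsSection D X → ∀ x, nabla cov V X x ∈ D x

/-- `∇ Ω = 0`. -/
def IsParallelForm [IsManifold I ∞ M]
    (cov : CovariantDerivative I E (TangentSpace I : M → Type _)) (Ω : BilinForm I M) : Prop :=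
  ∀ V W W' : VField I M, SmoothField V → SmoothField W → SmoothField W' →
    ∀ x, dirDeriv V (evalForm Ω W W') x -
      evalForm Ω (nabla cov V W) W' x - evalForm Ω W (nabla cov V W') x = 0

/-- `∇` is the canonical connection attached to `(Ω_1, …, Ω_k)`, `L` and `Q`: the smooth linear
connection that preserves each `L_α` and `Q`, for which every `Ω_α` is parallel, and whose torsion
satisfies `T(X, Y) = 0` for `X ∈ Γ(L)` and `Y ∈ Γ(Q)`. -/
structure IsCanonicalConnection [FiniteDimensional ℝ E] [CompleteSpace E] [IsManifold I ∞ M]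
    {k : ℕ} (Ω : Fin k → BilinForm I M) (L Q : Distribution I M)
    (cov : CovariantDerivative I E (TangentSpace I : M → Type _)) : Prop where
  smooth : cov.ContMDiffCovariantDerivative ∞
  preserves_subBundle : ∀ α, Preserves cov (subBundle Ω L α)
  preserves_transversal : Preserves cov Q
  parallel : ∀ α, IsParallelForm cov (Ω α)
  torsion : ∀ x, ∀ u ∈ L x, ∀ v ∈ Q x, cov.torsion x u v = 0

end General

/-! ### Local coordinates `(x_1, …, x_n, y_1, …, y_{kn})` -/

/-- Position of `x_i` among the coordinates `(x_1, …, x_n, y_1, …, y_{kn})`. -/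
def xIdx {n : ℕ} (k : ℕ) (i : Fin n) : Fin (n * (k + 1)) :=
  ⟨i, lt_of_lt_of_le i.2 (Nat.le_mul_of_pos_right n k.succ_pos)⟩

/-- Position of `y_{(α-1)n+i}` (with `α` counted from `1`; here `α : Fin k` is counted from `0`)
among the coordinates `(x_1, …, x_n, y_1, …, y_{kn})`. -/
def yIdx {n k : ℕ} (α : Fin k) (i : Fin n) : Fin (n * (k + 1)) :=
  ⟨n + (α * n + i), by
    have h : (α + 1) * n ≤ k * n := Nat.mul_le_mul_right n α.2
    have hi := i.2
    have e : n * (k + 1) = k * n + n := by ring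
    have e' : ((α : ℕ) + 1) * n = α * n + n := by ring
    omega⟩

section Coordinates

variable {d : ℕ} {M : Type*} [TopologicalSpace M] [ChartedSpace (EuclideanSpace ℝ (Fin d)) M]

/-- The `j`-th coordinate function of the chart `φ`. -/
def coord (φ : OpenPartialHomeomorph M (EuclideanSpace ℝ (Fin d))) (j : Fin d) (q : M) : ℝ :=
  φ q j

/-- The differential at `q` of the `j`-th coordinate function of the chart `φ`. -/
def dcoord (φ : OpenPartialHomeomorph M (EuclideanSpace ℝ (Fin d))) (j : Fin d) (q : M) :
    TangentSpace (𝓡 d) q →L[ℝ] ℝ :=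
  mvfderiv (𝓡 d) (coord φ j) q

/-- The `j`-th coordinate vector field of the chart `φ`: the pullback under `φ` of the constant
vector field `e_j`. -/
def coordField (φ : OpenPartialHomeomorph M (EuclideanSpace ℝ (Fin d))) (j : Fin d) :
    VField (𝓡 d) M :=
  mpullback (𝓡 d) 𝓘(ℝ, EuclideanSpace ℝ (Fin d)) φ (fun _ => EuclideanSpace.single j (1 : ℝ))

end Coordinates

/-- On its domain the chart `φ = (x_1, …, x_n, y_1, …, y_{kn})` is a Darboux chart for the
`k`-symplectic structure, adapted to `Q`. -/
structure IsAdaptedDarbouxChart {n k : ℕ} {M : Type*} [TopologicalSpace M]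
    [ChartedSpace (EuclideanSpace ℝ (Fin (n * (k + 1)))) M]
    (Ω : Fin k → BilinForm (𝓡 (n * (k + 1))) M) (L Q : Distribution (𝓡 (n * (k + 1))) M)
    (φ : OpenPartialHomeomorph M (EuclideanSpace ℝ (Fin (n * (k + 1))))) : Prop where
  /-- `Ω_α = ∑ i, dx_i ∧ dy_{(α-1)n+i}`. -/
  form_eq : ∀ α, ∀ q ∈ φ.source, ∀ u v : TangentSpace (𝓡 (n * (k + 1))) q,
    Ω α q u v = ∑ i : Fin n, wedge (dcoord φ (xIdx k i) q) (dcoord φ (yIdx α i) q) u v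
  /-- `𝓕` is described by `x_1 = const, …, x_n = const`: the tangent spaces of `𝓕` are the common
  kernels of the `dx_i`. -/
  tangent_eq : ∀ q ∈ φ.source, ∀ v : TangentSpace (𝓡 (n * (k + 1))) q,
    v ∈ L q ↔ ∀ i : Fin n, dcoord φ (xIdx k i) q v = 0
  /-- `𝓕` is described by `x_1 = const, …, x_n = const`: the leaves of `𝓕` restricted to the
  domain of the chart are the level sets of `(x_1, …, x_n)`. -/
  leaf_iff : ∀ a ∈ φ.source, ∀ b ∈ φ.source,
    SameLeafIn L φ.source a b ↔ ∀ i : Fin n, coord φ (xIdx k i) a = coord φ (xIdx k i) b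
  /-- `Q` is spanned by `∂/∂x_1, …, ∂/∂x_n`. -/
  transversal_eq : ∀ q ∈ φ.source,
    Q q = Submodule.span ℝ (Set.range fun i : Fin n => coordField φ (xIdx k i) q)

end KSymplectic

end

/-!
The canonical connection `∇` turns out to be torsion-free, so a flat `∇` has charts in which all
coordinate fields are parallel; everything preserved by `∇` has constant coefficients there.

*Torsion.* The subbundles `L_α` span `L`, so `∇` preserves `L` (`preserves_leaves`). The torsion of
two vectors of the integrable distribution `L` lies in `L`, which is isotropic. For the closed
parallel form `Ω_α` the identity `dΩ_α = 0` reads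
`Ω_α(T(u, v), w) - Ω_α(T(u, w), v) + Ω_α(T(v, w), u) = 0`, and as `T` vanishes on pairs from `L` and
`Q`, it gives `Ω_α(T(u, v), w) = 0` for `u, v ∈ L` and `w ∈ Q`. By nondegeneracy `T(u, v) = 0`. The
roles of `L` and `Q` can be exchanged, whence `torsion_eq_zero`.

*Flat charts.* In a chart `∇ = d + Γ`, with `Γ` symmetric and `dΓ + Γ ∧ Γ = 0`. New coordinates `f`
have parallel coordinate fields if `a = df` satisfies `da = a Γ`. This system for `f` and `a`
together is a single total differential equation, solved in `exists_hasFDerivAt_mul` along rays,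
with differentiability in the end point obtained from Grönwall's inequality. The result is
`exists_flat_chart`, in which the differential at the centre can be prescribed.

*Darboux charts.* Near every point there are dual frames `y_i` of `Q` and `e_{αi}` of `L`,
`Ω_β(y_j, e_{αi}) = δ_{αβ} δ_{ij}` (`exists_isAdaptedFrame`). A flat chart is chosen whose
coordinate frame at `p` is such a frame. The functions `Ω_α(X, X')` of parallel fields are constant,
which puts the `Ω_α` in normal form. A coordinate field splits into its components along `L` and
`Q`, both parallel, and a parallel field that vanishes at `p` vanishes identically, so a coordinate
field that is tangent to `L` or to `Q` at `p` is so everywhere (`constField_mem`). Hence `L` and `Q`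
are the spans of the coordinate fields they contain at `p`. Segments in the convex image of the
chart join the points of a level set of `(x_1, …, x_n)` inside a leaf.
-/

noncomputable section

namespace KSymplectic

/-! ### Total differential equations and affine coordinates -/

section TotalDifferential

variable {E : Type*} [NormedAddCommGroup E] [NormedSpace ℝ E]
  {R : Type*} [NormedRing R] [NormedAlgebra ℝ R] [CompleteSpace R]

/-- The bound `1 / 2` on the coefficient makes a single Picard–Lindelöf step cover `[0, 1]`. -/
theorem exists_linear_ode_solution {g : ℝ → R} (hg : ContinuousOn g (Icc 0 1))
    (hb : ∀ t ∈ Icc (0 : ℝ) 1, ‖g t‖ ≤ 1 / 2) :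
    ∃ α : ℝ → R, α 0 = 1 ∧
      ∀ t ∈ Icc (0 : ℝ) 1, HasDerivWithinAt α (α t * g t) (Icc 0 1) t := by
  -- the solution stays in the ball of radius `‖1‖ + 1`, on which the field has norm at most
  -- `(‖1‖ + (‖1‖ + 1)) / 2 ≤ ‖1‖ + 1`
  have hPL : IsPicardLindelof (fun t B : _ => B * g t) (tmin := 0) (tmax := 1)
      ⟨0, by simp⟩ (1 : R) (‖(1 : R)‖₊ + 1) 0 (‖(1 : R)‖₊ + 1) 1 := by
    refine ⟨fun t ht => ?_, fun B _ => continuousOn_const.mul hg, fun t ht B hB => ?_, by simp⟩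
    · refine (LipschitzWith.of_dist_le_mul fun x y => ?_).lipschitzOnWith
      rw [dist_eq_norm, dist_eq_norm, ← sub_mul]
      refine (norm_mul_le _ _).trans ?_
      have := hb t ht
      have := norm_nonneg (x - y)
      simp only [NNReal.coe_one, one_mul]
      nlinarith
    · have h1 : ‖B‖ ≤ ‖(1 : R)‖ + (‖(1 : R)‖ + 1) := by
        rw [mem_closedBall_iff_norm] at hB
        calc ‖B‖ = ‖1 + (B - 1)‖ := by congr 1; abel
          _ ≤ _ := (norm_add_le _ _).trans (add_le_add le_rfl (by simpa using hB))
      refine (norm_mul_le _ _).trans ?_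
      have := hb t ht
      have := norm_nonneg B
      have := norm_nonneg (1 : R)
      simp only [NNReal.coe_add, coe_nnnorm, NNReal.coe_one]
      nlinarith
  exact hPL.exists_eq_forall_mem_Icc_hasDerivWithinAt₀

/-- The total differential equation `dA = A Γ` is solvable if its integrability condition
`dΓ + Γ ∧ Γ = 0` holds. The value `A x` is obtained by solving the equation along the segment from
`x₀` to `x`. For the derivative at `x`, the solution `α_{x+h}` along the segment to `x + h` is
compared with `t ↦ α_x(t) (1 + t Γ(h))`: by integrability the latter solves the equation of the
former up to an error `O(‖h‖²)`, and Grönwall's inequality applies. -/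
theorem exists_hasFDerivAt_mul {Γ : E → E →L[ℝ] R} {Γ' : E → E →L[ℝ] E →L[ℝ] R} {x₀ : E} {r C : ℝ}
    (hr : 0 < r) (hC : 0 ≤ C) (hrC : C * r ≤ 1 / 2)
    (hΓ : ∀ x ∈ Metric.ball x₀ r, HasFDerivAt Γ (Γ' x) x)
    (hb : ∀ x ∈ Metric.ball x₀ r, ‖Γ x‖ ≤ C) (hb' : ∀ x ∈ Metric.ball x₀ r, ‖Γ' x‖ ≤ C)
    (hlip : ∀ x ∈ Metric.ball x₀ r, ∀ y ∈ Metric.ball x₀ r, ‖Γ' x - Γ' y‖ ≤ C * ‖x - y‖)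
    (hflat : ∀ x ∈ Metric.ball x₀ r, ∀ u v,
      Γ' x u v + Γ x u * Γ x v = Γ' x v u + Γ x v * Γ x u) :
    ∃ A : E → R, A x₀ = 1 ∧ ∀ x ∈ Metric.ball x₀ r,
      HasFDerivAt A ((ContinuousLinearMap.mul ℝ R (A x)).comp (Γ x)) x := by
  have hmem : ∀ x ∈ Metric.ball x₀ r, ∀ t ∈ Icc (0 : ℝ) 1,
      x₀ + t • (x - x₀) ∈ Metric.ball x₀ r := by
    intro x hx t ht
    rw [mem_ball_iff_norm] at hx ⊢
    rw [add_sub_cancel_left, norm_smul, Real.norm_of_nonneg ht.1]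
    nlinarith [norm_nonneg (x - x₀), ht.2]
  have hbd : ∀ x ∈ Metric.ball x₀ r, ∀ t ∈ Icc (0 : ℝ) 1,
      ‖Γ (x₀ + t • (x - x₀)) (x - x₀)‖ ≤ 1 / 2 := by
    intro x hx t ht
    refine ((Γ _).le_opNorm _).trans (le_trans ?_ hrC)
    rw [mem_ball_iff_norm] at hx
    exact mul_le_mul (hb _ (hmem x (by rwa [mem_ball_iff_norm]) t ht)) hx.le (norm_nonneg _) hC
  have hsol : ∀ x : E, ∃ α : ℝ → R, x ∈ Metric.ball x₀ r → (α 0 = 1 ∧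
      ∀ t ∈ Icc (0 : ℝ) 1,
        HasDerivWithinAt α (α t * Γ (x₀ + t • (x - x₀)) (x - x₀)) (Icc 0 1) t) := by
    intro x
    by_cases hx : x ∈ Metric.ball x₀ r
    · obtain ⟨α, hα⟩ := exists_linear_ode_solution
        (g := fun t => Γ (x₀ + t • (x - x₀)) (x - x₀)) (fun t ht => by
          have h1 : ContinuousAt Γ (x₀ + t • (x - x₀)) := (hΓ _ (hmem x hx t ht)).continuousAt
          have h2 : ContinuousAt (fun t : ℝ => x₀ + t • (x - x₀)) t := by fun_prop
          exact ((ContinuousAt.comp (g := Γ) (f := fun t : ℝ => x₀ + t • (x - x₀)) h1 h2).clm_apply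
            continuousAt_const).continuousWithinAt) (hbd x hx)
      exact ⟨α, fun _ => hα⟩
    · exact ⟨fun _ => 0, fun h => absurd h hx⟩
  choose α hα using hsol
  refine ⟨fun x => α x 1, ?_, fun x hx => ?_⟩
  · obtain ⟨h0, h1⟩ := hα x₀ (Metric.mem_ball_self hr)
    have := constant_of_derivWithin_zero (f := α x₀) (a := 0) (b := 1)
      (fun t ht => (h1 t ht).differentiableWithinAt) (fun t ht => by
        have := (h1 t (Ico_subset_Icc_self ht)).derivWithin
          (uniqueDiffOn_Icc_zero_one t (Ico_subset_Icc_self ht))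
        simpa using this) 1 (by simp)
    exact this.trans h0
  obtain ⟨h0, h1⟩ := hα x hx
  set w := x - x₀ with hw
  -- a bound of the radial solution at the fixed end point `x`
  obtain ⟨a, ha⟩ : ∃ a, ∀ t ∈ Icc (0 : ℝ) 1, ‖α x t‖ ≤ a :=
    isCompact_Icc.exists_bound_of_continuousOn fun t ht => (h1 t ht).continuousWithinAt
  have ha0 : 0 ≤ a := (norm_nonneg _).trans (ha 0 (by simp))
  have hwr : ‖w‖ ≤ r := by rw [mem_ball_iff_norm] at hx; exact hx.le
  set K := C * r + C + C * (C * r + C) with hK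
  have hest : ∀ h : E, x + h ∈ Metric.ball x₀ r →
      ‖α (x + h) 1 - α x 1 - α x 1 * Γ x h‖ ≤ (a * K * (Real.exp 1 - 1)) * ‖h‖ ^ 2 := by
    intro h hh
    obtain ⟨k0, k1⟩ := hα (x + h) hh
    have e1 : x + h - x₀ = w + h := by rw [hw]; abel
    rw [e1] at k1
    have hP : ∀ t ∈ Icc (0 : ℝ) 1, x₀ + t • w ∈ Metric.ball x₀ r := hmem x hx
    have hQ : ∀ t ∈ Icc (0 : ℝ) 1, x₀ + t • (w + h) ∈ Metric.ball x₀ r := by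
      rw [← e1]; exact hmem (x + h) hh
    have hbQ := hbd (x + h) hh
    rw [e1] at hbQ
    -- the approximate solution along the segment to `x + h`
    have hc : ∀ t ∈ Icc (0 : ℝ) 1, HasDerivWithinAt
        (fun t => α x t + α x t * (t • Γ (x₀ + t • w) h))
        (α x t * Γ (x₀ + t • w) w + ((α x t * Γ (x₀ + t • w) w) * (t • Γ (x₀ + t • w) h)
          + α x t * (t • Γ' (x₀ + t • w) w h + (1 : ℝ) • Γ (x₀ + t • w) h))) (Icc 0 1) t := by
      intro t ht
      have hd : HasDerivAt (fun t : ℝ => x₀ + t • w) w t := by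
        simpa using ((hasDerivAt_id t).smul_const w).const_add x₀
      have hG : HasDerivAt (fun t : ℝ => Γ (x₀ + t • w) h) (Γ' (x₀ + t • w) w h) t := by
        have := (hΓ _ (hP t ht)).comp_hasDerivAt t hd
        simpa using this.clm_apply (hasDerivAt_const t h)
      exact (h1 t ht).add ((h1 t ht).mul ((hasDerivAt_id t).smul hG).hasDerivWithinAt)
    have key : ∀ t ∈ Icc (0 : ℝ) 1,
        ‖(α x t * Γ (x₀ + t • w) w + ((α x t * Γ (x₀ + t • w) w) * (t • Γ (x₀ + t • w) h)
          + α x t * (t • Γ' (x₀ + t • w) w h + (1 : ℝ) • Γ (x₀ + t • w) h)))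
          - (α x t + α x t * (t • Γ (x₀ + t • w) h)) * Γ (x₀ + t • (w + h)) (w + h)‖
        ≤ a * K * ‖h‖ ^ 2 := by
      intro t ht
      set P := x₀ + t • w
      set Q := x₀ + t • (w + h)
      have hPt := hP t ht
      have hQt := hQ t ht
      have hQP : Q - P = t • h := by simp only [P, Q, smul_add]; abel
      have hn : ‖Q - P‖ ≤ ‖h‖ := by
        rw [hQP, norm_smul, Real.norm_of_nonneg ht.1]
        nlinarith [norm_nonneg h, ht.2]
      have hd1 : ‖Γ Q - Γ P‖ ≤ C * ‖h‖ :=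
        ((convex_ball x₀ r).norm_image_sub_le_of_norm_hasFDerivWithin_le
          (fun z hz => (hΓ z hz).hasFDerivWithinAt) hb' hPt hQt).trans
          (mul_le_mul_of_nonneg_left hn hC)
      have hd2 : ‖Γ Q - Γ P - Γ' P (Q - P)‖ ≤ C * ‖h‖ * ‖h‖ := by
        refine (((convex_ball x₀ r).inter (convex_closedBall P ‖h‖)
          ).norm_image_sub_le_of_norm_hasFDerivWithin_le' (f' := Γ') (C := C * ‖h‖)
          (fun z hz => (hΓ z hz.1).hasFDerivWithinAt) (fun z hz => ?_)
          ⟨hPt, Metric.mem_closedBall_self (norm_nonneg _)⟩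
          ⟨hQt, by rwa [mem_closedBall_iff_norm]⟩).trans
          (mul_le_mul_of_nonneg_left hn (by positivity))
        exact (hlip z hz.1 P hPt).trans (mul_le_mul_of_nonneg_left
          (mem_closedBall_iff_norm.1 hz.2) hC)
      have hfl := hflat P hPt w h
      -- after using integrability only quadratic terms in `h` remain
      have hrw : (α x t * Γ P w + ((α x t * Γ P w) * (t • Γ P h)
          + α x t * (t • Γ' P w h + (1 : ℝ) • Γ P h)))
          - (α x t + α x t * (t • Γ P h)) * Γ Q (w + h)
          = -(α x t * ((Γ Q - Γ P - Γ' P (Q - P)) w + (Γ Q - Γ P) h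
            + (t • Γ P h) * ((Γ Q - Γ P) w + Γ Q h))) := by
        have hfl' : Γ' P w h = Γ' P h w + Γ P h * Γ P w - Γ P w * Γ P h := by
          rw [← hfl]; abel
        rw [hQP, hfl']
        simp only [map_smul, map_add, _root_.sub_apply,
          _root_.smul_apply, mul_add, add_mul, mul_sub, smul_add, smul_sub,
          mul_smul_comm, smul_mul_assoc, one_smul, mul_assoc]
        abel
      rw [hrw, norm_neg]
      have hCh : 0 ≤ C * ‖h‖ := by positivity
      have b1 : ‖(Γ Q - Γ P - Γ' P (Q - P)) w‖ ≤ C * ‖h‖ * ‖h‖ * r :=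
        (ContinuousLinearMap.le_opNorm _ _).trans
          (mul_le_mul hd2 hwr (norm_nonneg _) (by positivity))
      have b2 : ‖(Γ Q - Γ P) h‖ ≤ C * ‖h‖ * ‖h‖ :=
        (ContinuousLinearMap.le_opNorm _ _).trans
          (mul_le_mul_of_nonneg_right hd1 (norm_nonneg _))
      have b3 : ‖t • Γ P h‖ ≤ C * ‖h‖ := by
        rw [norm_smul, Real.norm_of_nonneg ht.1]
        have : ‖Γ P h‖ ≤ C * ‖h‖ := (ContinuousLinearMap.le_opNorm _ _).trans
          (mul_le_mul_of_nonneg_right (hb P hPt) (norm_nonneg _))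
        nlinarith [norm_nonneg (Γ P h), ht.2, ht.1]
      have b4 : ‖(Γ Q - Γ P) w + Γ Q h‖ ≤ C * ‖h‖ * r + C * ‖h‖ := by
        refine (norm_add_le _ _).trans (add_le_add ?_ ?_)
        · exact (ContinuousLinearMap.le_opNorm _ _).trans
            (mul_le_mul hd1 hwr (norm_nonneg _) hCh)
        · exact (ContinuousLinearMap.le_opNorm _ _).trans
            (mul_le_mul_of_nonneg_right (hb Q hQt) (norm_nonneg _))
      have b5 : ‖(t • Γ P h) * ((Γ Q - Γ P) w + Γ Q h)‖
          ≤ C * ‖h‖ * (C * ‖h‖ * r + C * ‖h‖) :=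
        (norm_mul_le _ _).trans (mul_le_mul b3 b4 (norm_nonneg _) hCh)
      calc _ ≤ a * (C * ‖h‖ * ‖h‖ * r + C * ‖h‖ * ‖h‖ + C * ‖h‖ * (C * ‖h‖ * r + C * ‖h‖)) :=
            (norm_mul_le _ _).trans (mul_le_mul (ha t ht)
              ((norm_add_le _ _).trans (add_le_add ((norm_add_le _ _).trans
                (add_le_add b1 b2)) b5)) (norm_nonneg _) ha0)
        _ = _ := by rw [hK]; ring
    have hgr := dist_le_of_approx_trajectories_ODE_of_mem (E := R) (a := 0) (b := 1) (K := 1)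
      (v := fun t B => B * Γ (x₀ + t • (w + h)) (w + h)) (s := fun _ => univ)
      (f := α (x + h)) (g := fun t => α x t + α x t * (t • Γ (x₀ + t • w) h))
      (εf := 0) (δ := 0) (fun t ht => by
        refine (LipschitzWith.of_dist_le_mul fun y z => ?_).lipschitzOnWith
        rw [dist_eq_norm, dist_eq_norm, ← sub_mul]
        refine (norm_mul_le _ _).trans ?_
        have := hbQ t (Ico_subset_Icc_self ht)
        have := norm_nonneg (y - z)
        simp only [NNReal.coe_one, one_mul]
        nlinarith)
      (fun t ht => (k1 t ht).continuousWithinAt)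
      (fun t ht => (k1 t (Ico_subset_Icc_self ht)).mono_of_mem_nhdsWithin
        (Icc_mem_nhdsGE_of_mem ht))
      (fun t ht => by simp) (fun _ _ => mem_univ _)
      (fun t ht => (hc t ht).continuousWithinAt)
      (fun t ht => (hc t (Ico_subset_Icc_self ht)).mono_of_mem_nhdsWithin
        (Icc_mem_nhdsGE_of_mem ht))
      (fun t ht => by rw [dist_eq_norm]; exact key t (Ico_subset_Icc_self ht))
      (fun _ _ => mem_univ _) (by simp [k0, h0]) 1 (by simp)
    rw [dist_eq_norm, gronwallBound_of_K_ne_0 (by simp)] at hgr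
    have e2 : x₀ + w = x := by rw [hw]; abel
    simp only [one_smul, e2, sub_sub] at hgr ⊢
    refine hgr.trans (le_of_eq ?_)
    simp
    ring
  rw [hasFDerivAt_iff_isLittleO_nhds_zero]
  refine Asymptotics.IsBigO.trans_isLittleO (g := fun h : E => ‖h‖ ^ 2) ?_
    (Asymptotics.isLittleO_norm_pow_id one_lt_two)
  refine Asymptotics.IsBigO.of_bound (a * K * (Real.exp 1 - 1)) ?_
  have hev : ∀ᶠ h in 𝓝 (0 : E), x + h ∈ Metric.ball x₀ r := by
    have : Filter.Tendsto (fun h : E => x + h) (𝓝 0) (𝓝 x) := by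
      have h2 : Continuous fun h : E => x + h := by fun_prop
      simpa using h2.tendsto 0
    exact this (Metric.isOpen_ball.mem_nhds hx)
  filter_upwards [hev] with h hh
  simpa using hest h hh

/-- The local form of `exists_hasFDerivAt_mul` for a smooth form `Γ`: the ball is shrunk until the
bounds on `Γ` hold, and the solution is smooth. -/
theorem exists_local_hasFDerivAt_mul {Γ : E → E →L[ℝ] R} {V : Set E} (hV : IsOpen V) {x₀ : E}
    (hx₀ : x₀ ∈ V) (hΓ : ContDiffOn ℝ ∞ Γ V)
    (hflat : ∀ x ∈ V, ∀ u v,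
      fderiv ℝ Γ x u v + Γ x u * Γ x v = fderiv ℝ Γ x v u + Γ x v * Γ x u) :
    ∃ W ⊆ V, IsOpen W ∧ x₀ ∈ W ∧ ∃ A : E → R, A x₀ = 1 ∧ ContDiffOn ℝ ∞ A W ∧ ∀ x ∈ W,
      HasFDerivAt A ((ContinuousLinearMap.mul ℝ R (A x)).comp (Γ x)) x := by
  have hΓ' : ContDiffOn ℝ ∞ (fderiv ℝ Γ) V :=
    ((contDiffOn_infty_iff_fderiv_of_isOpen hV).1 hΓ).2
  have hVn := hV.mem_nhds hx₀
  obtain ⟨K, s, hs, hK⟩ := ((hΓ'.contDiffAt hVn).of_le (by simp : (1 : WithTop ℕ∞) ≤ ∞)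
    ).exists_lipschitzOnWith
  set C : ℝ := max (max (‖Γ x₀‖ + 1) (‖fderiv ℝ Γ x₀‖ + 1)) K
  have hC1 : ∀ᶠ x in 𝓝 x₀, ‖Γ x‖ < ‖Γ x₀‖ + 1 :=
    (hΓ.contDiffAt hVn).continuousAt.norm.eventually_lt_const (by simp)
  have hC2 : ∀ᶠ x in 𝓝 x₀, ‖fderiv ℝ Γ x‖ < ‖fderiv ℝ Γ x₀‖ + 1 :=
    have h : ContinuousAt (fun x => ‖fderiv ℝ Γ x‖) x₀ :=
      (continuous_norm (E := E →L[ℝ] E →L[ℝ] R)).continuousAt.comp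
        (hΓ'.contDiffAt hVn).continuousAt
    h.eventually_lt_const (lt_add_one _)
  obtain ⟨ε, hε, hball⟩ := Metric.eventually_nhds_iff_ball.1
    ((hC1.and hC2).and ((hV.eventually_mem hx₀).and hs))
  have hCpos : 0 < C := lt_of_lt_of_le (by positivity) ((le_max_left _ _).trans (le_max_left _ _))
  set r := min ε (1 / (2 * C)) with hr
  have hr0 : 0 < r := lt_min hε (by positivity)
  have hsub : Metric.ball x₀ r ⊆ Metric.ball x₀ ε := Metric.ball_subset_ball (min_le_left _ _)
  have hrC : C * r ≤ 1 / 2 := by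
    calc C * r ≤ C * (1 / (2 * C)) := mul_le_mul_of_nonneg_left (min_le_right _ _) hCpos.le
      _ = 1 / 2 := by field_simp
  obtain ⟨A, hA0, hA⟩ := exists_hasFDerivAt_mul (Γ := Γ) (Γ' := fderiv ℝ Γ) hr0 hCpos.le hrC
    (fun x hx => ((hΓ.contDiffAt (hV.mem_nhds (hball x (hsub hx)).2.1)).differentiableAt
      (by simp)).hasFDerivAt)
    (fun x hx => (hball x (hsub hx)).1.1.le.trans ((le_max_left _ _).trans (le_max_left _ _)))
    (fun x hx => (hball x (hsub hx)).1.2.le.trans ((le_max_right _ _).trans (le_max_left _ _)))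
    (fun x hx y hy => by
      have := hK.dist_le_mul x (hball x (hsub hx)).2.2 y (hball y (hsub hy)).2.2
      rw [dist_eq_norm, dist_eq_norm] at this
      exact this.trans (mul_le_mul_of_nonneg_right (le_max_right _ _) (norm_nonneg _)))
    (fun x hx => hflat x (hball x (hsub hx)).2.1)
  have hWV : Metric.ball x₀ r ⊆ V := fun x hx => (hball x (hsub hx)).2.1
  refine ⟨Metric.ball x₀ r, hWV, Metric.isOpen_ball, Metric.mem_ball_self hr0, A, hA0, ?_, hA⟩
  -- the equation expresses the derivative of `A` through `A` and the smooth form `Γ`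
  rw [contDiffOn_infty]
  intro m
  induction m with
  | zero => exact contDiffOn_zero.2 fun x hx => (hA x hx).continuousAt.continuousWithinAt
  | succ m ih =>
    push_cast
    refine (contDiffOn_succ_iff_fderiv_of_isOpen Metric.isOpen_ball).2
      ⟨fun x hx => (hA x hx).differentiableAt.differentiableWithinAt, by simp, ?_⟩
    refine ContDiffOn.congr (f := fun x => (ContinuousLinearMap.mul ℝ R (A x)).comp (Γ x)) ?_
      fun x hx => (hA x hx).fderiv
    exact (((ContinuousLinearMap.mul ℝ R).contDiff.comp_contDiffOn ih)).clm_comp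
      ((hΓ.mono hWV).of_le (by exact_mod_cast le_top))

end TotalDifferential

section AffineCoordinates

variable {E : Type*} [NormedAddCommGroup E] [NormedSpace ℝ E]

/-- The continuous linear maps that turn a connection form on `E` into one on `F = E × ℝ`, when
`ι`, `π`, `σ` are the inclusion and the two projections. They are obtained from abstract `ι`, `π`,
`σ` so that later computations use only their values. -/
theorem exists_extended_connection (E F : Type*) [NormedAddCommGroup E] [NormedSpace ℝ E]
    [NormedAddCommGroup F] [NormedSpace ℝ F] (ι : E →L[ℝ] F) (π : F →L[ℝ] E) (σ : F →L[ℝ] ℝ) :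
    ∃ (J : (E →L[ℝ] E →L[ℝ] E) →L[ℝ] E →L[ℝ] F →L[ℝ] F) (B : E →L[ℝ] F →L[ℝ] F)
      (K : (F →L[ℝ] F) →L[ℝ] E →L[ℝ] E), (∀ T v z, J T v z = ι (T v (π z))) ∧
      (∀ v z, B v z = ι (σ z • v)) ∧ (∀ T w, K T w = π (T (ι w))) ∧ ContDiff ℝ ∞ J := by
  refine ⟨ContinuousLinearMap.compL ℝ E (E →L[ℝ] E) (F →L[ℝ] F)
      ((ContinuousLinearMap.compL ℝ F E F ι).comp ((ContinuousLinearMap.compL ℝ F E E).flip π)),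
    (ContinuousLinearMap.compL ℝ F E F ι).comp (ContinuousLinearMap.smulRightL ℝ F E σ),
    (ContinuousLinearMap.compL ℝ E F E π).comp ((ContinuousLinearMap.compL ℝ E F F).flip ι),
    fun _ _ _ => rfl, fun _ _ => rfl, fun _ _ => rfl, ContinuousLinearMap.contDiff _⟩

/-- A flat torsion-free connection `d + Γ` has affine coordinates `f`, whose differential `a`
satisfies `da = a Γ`. Both `a` and `f` come out of one total differential equation, for the
connection on `E × ℝ` that is flat exactly when `d + Γ` is flat and torsion-free. -/
theorem exists_affine_coordinates [CompleteSpace E] {Γ : E → E →L[ℝ] E →L[ℝ] E} {V : Set E}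
    (hV : IsOpen V) {x₀ : E} (hx₀ : x₀ ∈ V) (hΓ : ContDiffOn ℝ ∞ Γ V)
    (htors : ∀ x ∈ V, ∀ u v, Γ x u v = Γ x v u)
    (hflat : ∀ x ∈ V, ∀ u v w, fderiv ℝ Γ x u v w + Γ x u (Γ x v w) =
      fderiv ℝ Γ x v u w + Γ x v (Γ x u w)) :
    ∃ W ⊆ V, IsOpen W ∧ x₀ ∈ W ∧ ∃ (f : E → E) (a : E → E →L[ℝ] E), ContDiffOn ℝ ∞ f W ∧
      a x₀ = ContinuousLinearMap.id ℝ E ∧ ∀ x ∈ W, HasFDerivAt f (a x) x ∧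
        HasFDerivAt a ((ContinuousLinearMap.compL ℝ E E E (a x)).comp (Γ x)) x := by
  -- the connection `(w, c) ↦ (Γ v w + c v, 0)` on the trivial bundle with fibre `E × ℝ`
  obtain ⟨J, B, K, hJ, hB, hK, hJs⟩ := exists_extended_connection E (E × ℝ)
    (ContinuousLinearMap.inl ℝ E ℝ) (ContinuousLinearMap.fst ℝ E ℝ)
    (ContinuousLinearMap.snd ℝ E ℝ)
  have hd : ∀ x ∈ V, HasFDerivAt (fun x => J (Γ x) + B) (J.comp (fderiv ℝ Γ x)) x := by
    intro x hx
    have h1 := ((hΓ.contDiffAt (hV.mem_nhds hx)).differentiableAt (by simp)).hasFDerivAt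
    have h2 := J.hasFDerivAt (x := Γ x)
    exact (h2.comp x h1).add_const B
  have hs : ContDiffOn ℝ ∞ (fun x => J (Γ x) + B) V :=
    (hJs.comp_contDiffOn hΓ).add contDiffOn_const
  obtain ⟨W, hWV, hWo, hxW, A, hA0, hAs, hA⟩ := exists_local_hasFDerivAt_mul
    (R := (E × ℝ) →L[ℝ] (E × ℝ)) (Γ := fun x => J (Γ x) + B) hV hx₀ hs (fun x hx u v => by
      rw [(hd x hx).fderiv]
      refine ContinuousLinearMap.ext fun ⟨w, c⟩ => ?_
      have h1 := hflat x hx u v w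
      have h2 := htors x hx u v
      simp only [ContinuousLinearMap.comp_apply, _root_.add_apply,
        mul_apply_eq_comp, hJ, hB, map_add, map_smul]
      simp
      rw [← add_assoc, h1, h2, add_assoc])
  refine ⟨W, hWV, hWo, hxW, fun x => (A x (0, 1)).1,
    fun x => K (A x), ?_, ?_, fun x hx => ⟨?_, ?_⟩⟩
  · exact contDiff_fst.comp_contDiffOn (hAs.clm_apply contDiffOn_const)
  · exact ContinuousLinearMap.ext fun w => by simp only [hA0, hK]; rfl
  · refine ((ContinuousLinearMap.fst ℝ E ℝ).hasFDerivAt.comp x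
      ((hA x hx).clm_apply (hasFDerivAt_const ((0 : E), (1 : ℝ)) x))).congr_fderiv
      (ContinuousLinearMap.ext fun v => ?_)
    have h1 : (J (Γ x) + B) v (0, 1) = (v, 0) := by
      simp only [_root_.add_apply, hJ, hB]
      simp
    have h2 : (A x * (J (Γ x) + B) v) (0, 1) = A x (v, 0) := by
      rw [mul_apply_eq_comp, h1]
    rw [hK]
    simpa using congrArg Prod.fst h2
  · refine (K.hasFDerivAt.comp x (hA x hx)).congr_fderiv
      (ContinuousLinearMap.ext fun v => ContinuousLinearMap.ext fun w => ?_)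
    have h1 : (J (Γ x) + B) v (w, 0) = (Γ x v w, 0) := by
      simp only [_root_.add_apply, hJ, hB]
      simp
    have h2 : (A x * (J (Γ x) + B) v) (w, 0) = A x (Γ x v w, 0) := by
      rw [mul_apply_eq_comp, h1]
    have h3 := congrArg Prod.fst h2
    simp only [ContinuousLinearMap.comp_apply, hK, ContinuousLinearMap.mul_apply',
      ContinuousLinearMap.compL_apply]
    exact h3

end AffineCoordinates

/-! ### Local vector fields and their extensions -/

section LocalFields

open Bundle

variable {E : Type*} [NormedAddCommGroup E] [NormedSpace ℝ E]
  {M : Type*} [TopologicalSpace M] [ChartedSpace E M] [IsManifold 𝓘(ℝ, E) ∞ M]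

theorem SmoothFieldOn.mono {X : VField 𝓘(ℝ, E) M} {U V : Set M} (hX : SmoothFieldOn X U)
    (hV : V ⊆ U) : SmoothFieldOn X V :=
  ContMDiffOn.mono hX hV

theorem SmoothField.smoothFieldOn {X : VField 𝓘(ℝ, E) M} (hX : SmoothField X) (U : Set M) :
    SmoothFieldOn X U :=
  SmoothFieldOn.mono hX (subset_univ U)

theorem SmoothFieldOn.mdifferentiableAt {X : VField 𝓘(ℝ, E) M} {U : Set M}
    (hX : SmoothFieldOn X U) (hU : IsOpen U) {q : M} (hq : q ∈ U) :
    MDifferentiableAt 𝓘(ℝ, E) 𝓘(ℝ, E).tangent (fun x => (⟨x, X x⟩ : TangentBundle 𝓘(ℝ, E) M)) q :=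
  (ContMDiffOn.contMDiffAt hX (hU.mem_nhds hq)).mdifferentiableAt (by simp)

theorem SmoothFieldOn.add {X Y : VField 𝓘(ℝ, E) M} {U : Set M}
    (hX : SmoothFieldOn X U) (hY : SmoothFieldOn Y U) : SmoothFieldOn (X + Y) U :=
  ContMDiffOn.add_section hX hY

theorem SmoothFieldOn.sub {X Y : VField 𝓘(ℝ, E) M} {U : Set M}
    (hX : SmoothFieldOn X U) (hY : SmoothFieldOn Y U) : SmoothFieldOn (X - Y) U :=
  ContMDiffOn.sub_section hX hY

theorem SmoothFieldOn.smul {f : M → ℝ} {X : VField 𝓘(ℝ, E) M} {U : Set M}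
    (hf : ContMDiffOn 𝓘(ℝ, E) 𝓘(ℝ) ∞ f U) (hX : SmoothFieldOn X U) : SmoothFieldOn (f • X) U :=
  ContMDiffOn.smul_section hf hX

theorem SmoothFieldOn.sum {ι : Type*} {s : Finset ι} {X : ι → VField 𝓘(ℝ, E) M} {U : Set M}
    (hX : ∀ i ∈ s, SmoothFieldOn (X i) U) : SmoothFieldOn (fun x => ∑ i ∈ s, X i x) U :=
  ContMDiffOn.sum_section hX

theorem IsTwoForm.contMDiffOn_evalForm {Ω : BilinForm 𝓘(ℝ, E) M} (hΩ : IsTwoForm Ω)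
    {X Y : VField 𝓘(ℝ, E) M} {U : Set M} (hX : SmoothFieldOn X U) (hY : SmoothFieldOn Y U) :
    ContMDiffOn 𝓘(ℝ, E) 𝓘(ℝ) ∞ (evalForm Ω X Y) U := by
  have h := ContMDiffOn.clm_bundle_apply₂ (F₁ := E) (F₂ := E) (F₃ := ℝ) (n := ∞)
    (E₁ := (TangentSpace 𝓘(ℝ, E) : M → Type _)) (E₂ := (TangentSpace 𝓘(ℝ, E) : M → Type _))
    (E₃ := Bundle.Trivial M ℝ) (b := fun m => m) (s := U) (v := X) (w := Y)
    hΩ.smooth.contMDiffOn hX hY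
  intro x hx
  have := h x hx
  rw [contMDiffWithinAt_totalSpace] at this
  exact this.2

theorem smoothField_nabla {cov : CovariantDerivative 𝓘(ℝ, E) E (TangentSpace 𝓘(ℝ, E) : M → Type _)}
    (hcov : cov.ContMDiffCovariantDerivative ∞) {X Y : VField 𝓘(ℝ, E) M}
    (hX : SmoothField X) (hY : SmoothField Y) : SmoothField (nabla cov X Y) := by
  have h := hcov.contMDiff.contMDiff (σ := Y) hY
  exact ContMDiffOn.clm_bundle_apply (F₁ := E) (F₂ := E)
    (E₁ := (TangentSpace 𝓘(ℝ, E) : M → Type _)) (E₂ := (TangentSpace 𝓘(ℝ, E) : M → Type _))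
    (b := fun m => m) (v := X) h hX

theorem cov_congr (cov : CovariantDerivative 𝓘(ℝ, E) E (TangentSpace 𝓘(ℝ, E) : M → Type _))
    {X Y : VField 𝓘(ℝ, E) M} {U V : Set M} (hX : SmoothFieldOn X U) (hU : IsOpen U)
    (hY : SmoothFieldOn Y V) (hV : IsOpen V) {q : M} (hqU : q ∈ U) (hqV : q ∈ V)
    (h : ∀ᶠ x in 𝓝 q, X x = Y x) : cov X q = cov Y q :=
  cov.isCovariantDerivativeOnUniv.congr_of_eventuallyEq (hX.mdifferentiableAt hU hqU)
    (hY.mdifferentiableAt hV hqV) Filter.univ_mem h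

omit [IsManifold 𝓘(ℝ, E) ∞ M] in
theorem mvfderiv_congr {f g : M → ℝ} {q : M} (h : f =ᶠ[𝓝 q] g) :
    mvfderiv 𝓘(ℝ, E) f q = mvfderiv 𝓘(ℝ, E) g q := by
  ext v
  change mfderiv 𝓘(ℝ, E) 𝓘(ℝ) f q v = mfderiv 𝓘(ℝ, E) 𝓘(ℝ) g q v
  rw [h.mfderiv_eq]
  rfl

section BumpFunctions

variable [FiniteDimensional ℝ E] [T2Space M]

/-- A local section of `D` agrees near a given point with a global one: multiply by a bump
function. -/
theorem exists_isSection {D : Distribution 𝓘(ℝ, E) M} {X : VField 𝓘(ℝ, E) M} {U : Set M}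
    (hU : IsOpen U) (hX : SmoothFieldOn X U) (hD : ∀ x ∈ U, X x ∈ D x) {q : M} (hq : q ∈ U) :
    ∃ X' : VField 𝓘(ℝ, E) M, IsSection D X' ∧ ∀ᶠ x in 𝓝 q, X' x = X x := by
  obtain ⟨b, -, hb⟩ := (SmoothBumpFunction.nhds_basis_tsupport (I := 𝓘(ℝ, E)) q).mem_iff.1
    (hU.mem_nhds hq)
  refine ⟨(b : M → ℝ) • X, ⟨?_, fun x => ?_⟩, ?_⟩
  · have : ContMDiff 𝓘(ℝ, E) 𝓘(ℝ, E).tangent ∞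
        (fun x => (Bundle.TotalSpace.mk' E x (((b : M → ℝ) • X) x) : TangentBundle 𝓘(ℝ, E) M)) :=
      ContMDiffOn.smul_section_of_tsupport b.contMDiff.contMDiffOn hU hb hX
    exact this.contMDiffOn
  · by_cases hx : x ∈ U
    · exact (D x).smul_mem _ (hD x hx)
    · have : b x = 0 := image_eq_zero_of_notMem_tsupport fun h => hx (hb h)
      simp [this]
  · filter_upwards [b.eventuallyEq_one] with x hx
    simp [hx]

theorem exists_smoothField {X : VField 𝓘(ℝ, E) M} {U : Set M}
    (hU : IsOpen U) (hX : SmoothFieldOn X U) {q : M} (hq : q ∈ U) :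
    ∃ X' : VField 𝓘(ℝ, E) M, SmoothField X' ∧ ∀ᶠ x in 𝓝 q, X' x = X x := by
  obtain ⟨X', h1, h2⟩ := exists_isSection (D := fun _ => ⊤) hU hX (fun _ _ => trivial) hq
  exact ⟨X', h1.1, h2⟩

end BumpFunctions
end LocalFields

/-! ### Vector fields in a chart -/

section Charts

open Bundle

variable {E : Type*} [NormedAddCommGroup E] [NormedSpace ℝ E]
  {M : Type*} [TopologicalSpace M] [ChartedSpace E M]

/-- The differential `dφ_q : T_qM → E` of a chart `φ`. -/
def chartDeriv (φ : OpenPartialHomeomorph M E) (q : M) : TangentSpace 𝓘(ℝ, E) q →L[ℝ] E :=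
  mfderiv 𝓘(ℝ, E) 𝓘(ℝ, E) φ q

/-- The vector field on the domain of the chart `φ` whose expression in the chart is `g`. -/
def chartField (φ : OpenPartialHomeomorph M E) (g : E → E) : VField 𝓘(ℝ, E) M :=
  mpullback 𝓘(ℝ, E) 𝓘(ℝ, E) φ g

theorem chartField_apply (φ : OpenPartialHomeomorph M E) (g : E → E) (q : M) :
    chartField φ g q = (chartDeriv φ q).inverse (g (φ q)) := rfl

variable {φ : OpenPartialHomeomorph M E}
  (hφ : φ ∈ IsManifold.maximalAtlas 𝓘(ℝ, E) ∞ M) {q : M} (hq : q ∈ φ.source)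

include hφ in
theorem mdifferentiable_of_mem_maximalAtlas : φ.MDifferentiable 𝓘(ℝ, E) 𝓘(ℝ, E) :=
  ⟨(contMDiffOn_of_mem_maximalAtlas hφ).mdifferentiableOn (by simp),
    (contMDiffOn_symm_of_mem_maximalAtlas hφ).mdifferentiableOn (by simp)⟩

include hφ hq

theorem isInvertible_chartDeriv : (chartDeriv φ q).IsInvertible :=
  ⟨(mdifferentiable_of_mem_maximalAtlas hφ).mfderiv hq, rfl⟩

theorem chartDeriv_chartField (g : E → E) : chartDeriv φ q (chartField φ g q) = g (φ q) :=
  (isInvertible_chartDeriv hφ hq).self_apply_inverse _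

theorem chartField_chartDeriv (u : TangentSpace 𝓘(ℝ, E) q) :
    chartField φ (fun _ => chartDeriv φ q u) q = u :=
  (isInvertible_chartDeriv hφ hq).inverse_apply_self _

theorem mvfderiv_comp_chart {f : E → ℝ} (hf : DifferentiableAt ℝ f (φ q))
    (u : TangentSpace 𝓘(ℝ, E) q) :
    mvfderiv 𝓘(ℝ, E) (f ∘ φ) q u = fderiv ℝ f (φ q) (chartDeriv φ q u) := by
  change mfderiv 𝓘(ℝ, E) 𝓘(ℝ) (f ∘ φ) q u = _
  rw [mfderiv_comp q hf.mdifferentiableAt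
    ((mdifferentiable_of_mem_maximalAtlas hφ).mdifferentiableAt hq), mfderiv_eq_fderiv]
  rfl

variable [IsManifold 𝓘(ℝ, E) ∞ M]

omit hq in
theorem smoothFieldOn_chartField [CompleteSpace E] {g : E → E} {W : Set E} (hW : IsOpen W)
    (hg : ContDiffOn ℝ ∞ g W) :
    SmoothFieldOn (chartField φ g) (φ.source ∩ φ ⁻¹' W) := by
  intro x hx
  have h1 : ContMDiffAt 𝓘(ℝ, E) 𝓘(ℝ, E).tangent ∞
      (fun y => (⟨y, g y⟩ : TangentBundle 𝓘(ℝ, E) E)) (φ x) :=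
    contMDiffAt_vectorSpace_iff_contDiffAt.2 (hg.contDiffAt (hW.mem_nhds hx.2))
  exact (ContMDiffAt.mpullback_vectorField_preimage (n := ∞) h1
    (contMDiffAt_of_mem_maximalAtlas hφ hx.1) (isInvertible_chartDeriv hφ hx.1)
    (by simp)).contMDiffWithinAt

omit hq in
theorem smoothFieldOn_constField [CompleteSpace E] (c : E) :
    SmoothFieldOn (chartField φ fun _ => c) φ.source := by
  simpa using smoothFieldOn_chartField hφ isOpen_univ (contDiffOn_const (c := c))

theorem mlieBracket_constField [CompleteSpace E] (c c' : E) :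
    mlieBracket 𝓘(ℝ, E) (chartField φ fun _ => c) (chartField φ fun _ => c') q = 0 := by
  have h (c : E) : MDifferentiableAt 𝓘(ℝ, E) 𝓘(ℝ, E).tangent
      (fun y => (⟨y, c⟩ : TangentBundle 𝓘(ℝ, E) E)) (φ q) :=
    ((contMDiffAt_vectorSpace_iff_contDiffAt (n := 1)).2
      contDiffAt_const).mdifferentiableAt one_ne_zero
  have hz : mlieBracket 𝓘(ℝ, E) (M := E) (fun _ => c) (fun _ => c') (φ q) = 0 := by
    have h3 := congrFun (mlieBracketWithin_eq_lieBracketWithin (𝕜 := ℝ) (E := E) (V := fun _ => c)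
      (W := fun _ => c') (s := univ)) (φ q)
    exact h3.trans
      (by simp [lieBracketWithin] : lieBracketWithin ℝ (fun _ : E => c) (fun _ => c') univ _ = 0)
  have : IsManifold 𝓘(ℝ, E) (minSmoothness ℝ 2) M := by
    rw [minSmoothness_of_isRCLikeNormedField]
    exact IsManifold.of_le (n := ∞) ENat.LEInfty.out
  have h2 := mpullback_mlieBracket (h c) (h c') (n := ∞)
    (contMDiffAt_of_mem_maximalAtlas hφ hq)
    (by rw [minSmoothness_of_isRCLikeNormedField]; exact ENat.LEInfty.out)
  rw [mpullback_apply, hz, map_zero] at h2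
  exact h2.symm

omit hq in
theorem contDiffOn_chartDeriv [CompleteSpace E] {X : VField 𝓘(ℝ, E) M}
    (hX : SmoothFieldOn X φ.source) :
    ContDiffOn ℝ ∞ (fun x => chartDeriv φ (φ.symm x) (X (φ.symm x))) φ.target := by
  have h0 := mdifferentiable_of_mem_maximalAtlas hφ
  have hinv : ∀ x (hx : x ∈ φ.target), (mfderiv 𝓘(ℝ, E) 𝓘(ℝ, E) φ.symm x).IsInvertible :=
    fun x hx => ⟨h0.symm.mfderiv hx, rfl⟩
  have h1 : ∀ x ∈ φ.target, ContDiffAt ℝ ∞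
      (mpullback 𝓘(ℝ, E) 𝓘(ℝ, E) φ.symm X : E → E) x := by
    intro x hx
    refine contMDiffAt_vectorSpace_iff_contDiffAt.1
      (ContMDiffAt.mpullback_vectorField_preimage (n := ∞) (f := φ.symm) (V := X) ?_
      (contMDiffAt_symm_of_mem_maximalAtlas hφ hx) (hinv x hx) (by simp))
    exact ContMDiffOn.contMDiffAt hX (φ.open_source.mem_nhds (φ.map_target hx))
  refine ContDiffOn.congr (fun x hx => (h1 x hx).contDiffWithinAt) fun x hx => ?_
  have h2 := h0.comp_symm_deriv hx
  rw [mpullback_apply]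
  have h3 := congrArg (fun T => T ((mfderiv 𝓘(ℝ, E) 𝓘(ℝ, E) φ.symm x).inverse (X (φ.symm x)))) h2
  simp only [ContinuousLinearMap.comp_apply] at h3
  rw [(hinv x hx).self_apply_inverse] at h3
  exact h3

end Charts

/-! ### The hypotheses for local vector fields -/

section Localization

variable {E : Type*} [NormedAddCommGroup E] [NormedSpace ℝ E] [FiniteDimensional ℝ E]
  {M : Type*} [TopologicalSpace M] [T2Space M] [ChartedSpace E M] [IsManifold 𝓘(ℝ, E) ∞ M]
  {cov : CovariantDerivative 𝓘(ℝ, E) E (TangentSpace 𝓘(ℝ, E) : M → Type _)}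
  {U : Set M} {q : M}

theorem exists_smoothField_apply_eq (u : TangentSpace 𝓘(ℝ, E) q) :
    ∃ X : VField 𝓘(ℝ, E) M, SmoothField X ∧ X q = u := by
  have : CompleteSpace E := FiniteDimensional.complete ℝ E
  have hφ := IsManifold.chart_mem_maximalAtlas (I := 𝓘(ℝ, E)) (n := ∞) q
  obtain ⟨X, h1, h2⟩ := exists_smoothField (chartAt E q).open_source
    (smoothFieldOn_constField hφ (chartDeriv (chartAt E q) q u)) (mem_chart_source E q)
  exact ⟨X, h1, h2.self_of_nhds.trans (chartField_chartDeriv hφ (mem_chart_source E q) u)⟩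

theorem Preserves.cov_mem {D : Distribution 𝓘(ℝ, E) M} (h : Preserves cov D) (hU : IsOpen U)
    {X : VField 𝓘(ℝ, E) M} (hX : SmoothFieldOn X U) (hD : ∀ x ∈ U, X x ∈ D x) (hq : q ∈ U)
    (u : TangentSpace 𝓘(ℝ, E) q) : cov X q u ∈ D q := by
  obtain ⟨V, hV, rfl⟩ := exists_smoothField_apply_eq u
  obtain ⟨X', hX', he⟩ := exists_isSection hU hX hD hq
  have := h V X' hV hX' q
  rwa [nabla, cov_congr cov hX'.1 isOpen_univ hX hU (mem_univ q) hq he] at this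

theorem IsParallelForm.mvfderiv_evalForm {Ω : BilinForm 𝓘(ℝ, E) M} (h : IsParallelForm cov Ω)
    (hU : IsOpen U) {X Y : VField 𝓘(ℝ, E) M} (hX : SmoothFieldOn X U) (hY : SmoothFieldOn Y U)
    (hq : q ∈ U) (u : TangentSpace 𝓘(ℝ, E) q) :
    mvfderiv 𝓘(ℝ, E) (evalForm Ω X Y) q u = Ω q (cov X q u) (Y q) + Ω q (X q) (cov Y q u) := by
  obtain ⟨V, hV, rfl⟩ := exists_smoothField_apply_eq u
  obtain ⟨X', hX', heX⟩ := exists_smoothField hU hX hq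
  obtain ⟨Y', hY', heY⟩ := exists_smoothField hU hY hq
  have h1 := h V X' Y' hV hX' hY' q
  have h2 : evalForm Ω X' Y' =ᶠ[𝓝 q] evalForm Ω X Y := by
    filter_upwards [heX, heY] with x h1 h2
    rw [evalForm, evalForm, h1, h2]
  rw [dirDeriv, mvfderiv_congr h2, evalForm, evalForm, nabla, nabla,
    cov_congr cov hX' isOpen_univ hX hU (mem_univ q) hq heX,
    cov_congr cov hY' isOpen_univ hY hU (mem_univ q) hq heY, heX.self_of_nhds,
    heY.self_of_nhds] at h1
  linarith

theorem SmoothFieldOn.nabla (hcov : cov.ContMDiffCovariantDerivative ∞) (hU : IsOpen U)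
    {X Y : VField 𝓘(ℝ, E) M} (hX : SmoothFieldOn X U) (hY : SmoothFieldOn Y U) :
    SmoothFieldOn (nabla cov X Y) U := by
  intro x hx
  obtain ⟨X', hX', heX⟩ := exists_smoothField hU hX hx
  obtain ⟨Y', hY', heY⟩ := exists_smoothField hU hY hx
  have h1 := ContMDiffOn.contMDiffAt (smoothField_nabla hcov hX' hY') (x := x) Filter.univ_mem
  refine (h1.congr_of_eventuallyEq ?_).contMDiffWithinAt
  filter_upwards [heX, heY.eventually_nhds, hU.mem_nhds hx] with z h1 h2 hz
  rw [KSymplectic.nabla, KSymplectic.nabla, h1,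
    cov_congr cov hY' isOpen_univ hY hU (mem_univ z) hz h2]

theorem IsFlat.curvature_eq_zero (h : IsFlat cov) (hcov : cov.ContMDiffCovariantDerivative ∞)
    (hU : IsOpen U) {X Y Z : VField 𝓘(ℝ, E) M} (hX : SmoothFieldOn X U) (hY : SmoothFieldOn Y U)
    (hZ : SmoothFieldOn Z U) (hq : q ∈ U) : curvature cov X Y Z q = 0 := by
  obtain ⟨X', hX', heX⟩ := exists_smoothField hU hX hq
  obtain ⟨Y', hY', heY⟩ := exists_smoothField hU hY hq
  obtain ⟨Z', hZ', heZ⟩ := exists_smoothField hU hZ hq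
  have he {Y Y' : VField 𝓘(ℝ, E) M} (hY : SmoothFieldOn Y U) (hY' : SmoothField Y')
      (heY : ∀ᶠ x in 𝓝 q, Y' x = Y x) :
      cov (nabla cov Y' Z') q = cov (nabla cov Y Z) q := by
    refine cov_congr cov (smoothField_nabla hcov hY' hZ') isOpen_univ (hY.nabla hcov hU hZ)
      hU (mem_univ q) hq ?_
    filter_upwards [heY, heZ.eventually_nhds, hU.mem_nhds hq] with z h1 h2 hz
    rw [nabla, nabla, h1, cov_congr cov hZ' isOpen_univ hZ hU (mem_univ z) hz h2]
  have h1 := h X' Y' Z' hX' hY' hZ' q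
  simp only [curvature, Pi.sub_apply] at h1 ⊢
  rw [nabla, he hY hY' heY, nabla, he hX hX' heX, nabla,
    Filter.EventuallyEq.mlieBracket_vectorField_eq heX heY, heX.self_of_nhds, heY.self_of_nhds,
    cov_congr cov hZ' isOpen_univ hZ hU (mem_univ q) hq heZ] at h1
  exact h1

end Localization

/-! ### Affine charts of a vector space -/

section AffineChart

variable {E : Type*} [NormedAddCommGroup E] [NormedSpace ℝ E] [CompleteSpace E]

/-- Affine coordinates of a flat torsion-free connection form a chart with convex image and
prescribed differential `ℓ` at the centre. The last clause says that `y ↦ (a y)⁻¹ c`, the field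
which is constantly `c` in the new coordinates, is parallel. -/
theorem exists_affine_chart {Γ : E → E →L[ℝ] E →L[ℝ] E} {V : Set E}
    (hV : IsOpen V) {x₀ : E} (hx₀ : x₀ ∈ V) (hΓ : ContDiffOn ℝ ∞ Γ V)
    (htors : ∀ x ∈ V, ∀ u v, Γ x u v = Γ x v u)
    (hflat : ∀ x ∈ V, ∀ u v w, fderiv ℝ Γ x u v w + Γ x u (Γ x v w) =
      fderiv ℝ Γ x v u w + Γ x v (Γ x u w)) (ℓ : E ≃L[ℝ] E) :
    ∃ e : OpenPartialHomeomorph E E, e.source ⊆ V ∧ x₀ ∈ e.source ∧ Convex ℝ e.target ∧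
      ContDiffOn ℝ ∞ e e.source ∧ ContDiffOn ℝ ∞ e.symm e.target ∧
      ∃ a : E → E →L[ℝ] E, a x₀ = ℓ ∧ ∀ x ∈ e.source, (a x).IsInvertible ∧
        HasFDerivAt e (a x) x ∧
        ∀ c, HasFDerivAt (fun y => (a y).inverse c) (-(Γ x).flip ((a x).inverse c)) x := by
  obtain ⟨W, hWV, hW, hxW, f₀, a₀, hf₀, ha₀, hfa⟩ :=
    exists_affine_coordinates hV hx₀ hΓ htors hflat
  set f : E → E := fun x => ℓ (f₀ x) with hfdef
  set a : E → E →L[ℝ] E := fun x => (ℓ : E →L[ℝ] E).comp (a₀ x) with hadef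
  have hax : a x₀ = ℓ := by rw [hadef]; simp [ha₀]
  have hf : ContDiffOn ℝ ∞ f W := ℓ.contDiff.comp_contDiffOn hf₀
  have hfd : ∀ x ∈ W, HasFDerivAt f (a x) x := fun x hx =>
    (ℓ : E →L[ℝ] E).hasFDerivAt.comp x (hfa x hx).1
  have had : ∀ x ∈ W, HasFDerivAt a ((ContinuousLinearMap.compL ℝ E E E (a x)).comp (Γ x)) x :=
    fun x hx => ((ContinuousLinearMap.compL ℝ E E E (ℓ : E →L[ℝ] E)).hasFDerivAt.comp x
      (hfa x hx).2)
  have hac : ContinuousOn a W := fun x hx => (had x hx).continuousAt.continuousWithinAt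
  have hfc := hf.contDiffAt (hW.mem_nhds hxW)
  have hfd₀ : HasFDerivAt f (ℓ : E →L[ℝ] E) x₀ := hax ▸ hfd x₀ hxW
  set e₀ := hfc.toOpenPartialHomeomorph f hfd₀ (by simp)
  have he₀ : ⇑e₀ = f := rfl
  have hx₀e : x₀ ∈ e₀.source := hfc.mem_toOpenPartialHomeomorph_source hfd₀ (by simp)
  -- points at which the differential of `f` is invertible
  have hop : IsOpen (W ∩ a ⁻¹' range ((↑) : (E ≃L[ℝ] E) → E →L[ℝ] E)) :=
    hac.isOpen_inter_preimage hW ContinuousLinearEquiv.isOpen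
  set e₁ := e₀.restrOpen _ hop
  have hx₀1 : x₀ ∈ e₁.source := ⟨hx₀e, hxW, ⟨ℓ, hax.symm⟩⟩
  obtain ⟨ε, hε, hball⟩ := Metric.isOpen_iff.1 e₁.open_target _ (e₁.map_source hx₀1)
  set e := e₁.trans (OpenPartialHomeomorph.ofSet (Metric.ball (e₁ x₀) ε) Metric.isOpen_ball)
  have hsub : e.source ⊆ e₁.source := fun x hx => hx.1
  have hsW : e.source ⊆ W := fun x hx => (hsub hx).2.1
  have hinv : ∀ x ∈ e.source, (a x).IsInvertible := fun x hx => (hsub hx).2.2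
  have hef : ⇑e = f := rfl
  have htarget : e.target = Metric.ball (e₁ x₀) ε := by
    ext y
    constructor
    · exact fun hy => hy.1
    · exact fun hy => ⟨hy, hball hy⟩
  refine ⟨e, hsW.trans hWV, ⟨hx₀1, Metric.mem_ball_self hε⟩, ?_, ?_, ?_, a, hax,
    fun x hx => ⟨hinv x hx, hfd x (hsW hx), fun c => ?_⟩⟩
  · rw [htarget]; exact convex_ball _ _
  · exact hf.mono hsW
  · intro y hy
    have hys := e.map_target hy
    obtain ⟨A, hA⟩ := hinv _ hys
    refine (e.contDiffAt_symm (f₀' := A) hy ?_ ?_).contDiffWithinAt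
    · rw [hA]; exact hfd _ (hsW hys)
    · exact hf.contDiffAt (hW.mem_nhds (hsW hys))
  · have hg : DifferentiableAt ℝ (fun y => (a y).inverse c) x :=
      ((((hinv x hx).contDiffAt_map_inverse (n := 1)).differentiableAt one_ne_zero).comp x
        (had x (hsW hx)).differentiableAt).clm_apply (differentiableAt_const c)
    -- differentiate the identity `a y ((a y)⁻¹ c) = c`
    have h1 := (had x (hsW hx)).clm_apply hg.hasFDerivAt
    have h2 : HasFDerivAt (fun y => a y ((a y).inverse c)) (0 : E →L[ℝ] E) x := by
      refine (hasFDerivAt_const c x).congr_of_eventuallyEq ?_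
      filter_upwards [e.open_source.mem_nhds hx] with y hy
      exact (hinv y hy).self_apply_inverse c
    have h3 := h1.unique h2
    refine hg.hasFDerivAt.congr_fderiv (ContinuousLinearMap.ext fun v => ?_)
    have h4 := congrArg (fun T => T v) h3
    have hinj : Function.Injective (a x) := by
      obtain ⟨A, hA⟩ := hinv x hx
      rw [← hA]
      exact A.injective
    apply hinj
    simp only [_root_.add_apply, ContinuousLinearMap.comp_apply, ContinuousLinearMap.flip_apply,
      ContinuousLinearMap.compL_apply, _root_.zero_apply] at h4
    rw [_root_.neg_apply, ContinuousLinearMap.flip_apply, map_neg]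
    exact eq_neg_of_add_eq_zero_left h4

end AffineChart

/-! ### The Christoffel form of a connection in a chart -/

section Christoffel

variable {E : Type*} [NormedAddCommGroup E] [NormedSpace ℝ E] [FiniteDimensional ℝ E]
  {M : Type*} [TopologicalSpace M] [ChartedSpace E M] [IsManifold 𝓘(ℝ, E) ∞ M]
  (cov : CovariantDerivative 𝓘(ℝ, E) E (TangentSpace 𝓘(ℝ, E) : M → Type _))

omit [FiniteDimensional ℝ E] in
/-- The Leibniz rule for a finite combination of vector fields. -/
theorem cov_sum_smul {ι : Type*} (s : Finset ι) {f : ι → M → ℝ} {X : ι → VField 𝓘(ℝ, E) M} {q : M}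
    (hf : ∀ i, MDifferentiableAt 𝓘(ℝ, E) 𝓘(ℝ) (f i) q)
    (hX : ∀ i, MDifferentiableAt 𝓘(ℝ, E) 𝓘(ℝ, E).tangent
      (fun x => (⟨x, X i x⟩ : TangentBundle 𝓘(ℝ, E) M)) q) (u : TangentSpace 𝓘(ℝ, E) q) :
    cov (fun x => ∑ i ∈ s, f i x • X i x) q u =
      ∑ i ∈ s, (f i q • cov (X i) q u + mvfderiv 𝓘(ℝ, E) (f i) q u • X i q) := by
  classical
  induction s using Finset.induction_on with
  | empty =>
    have : (fun x => ∑ i ∈ (∅ : Finset ι), f i x • X i x) = (0 : VField 𝓘(ℝ, E) M) := by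
      ext x; simp
    rw [this, cov.zero]; simp
  | insert i s hi ih =>
    have h1 : (fun x => ∑ i ∈ insert i s, f i x • X i x) =
        (f i • X i : VField 𝓘(ℝ, E) M) + fun x => ∑ i ∈ s, f i x • X i x := by
      funext x; simp [Finset.sum_insert hi]
    have hs : MDifferentiableAt 𝓘(ℝ, E) 𝓘(ℝ, E).tangent
        (fun x => (⟨x, ∑ i ∈ s, f i x • X i x⟩ : TangentBundle 𝓘(ℝ, E) M)) q :=
      MDifferentiableAt.sum_section (t := fun i => f i • X i)
        fun j _ => (hf j).smul_section (hX j)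
    rw [h1, cov.isCovariantDerivativeOnUniv.add (σ := f i • X i)
      (σ' := fun x => ∑ i ∈ s, f i x • X i x) ((hf i).smul_section (hX i)) hs,
      cov.isCovariantDerivativeOnUniv.leibniz (hX i) (hf i), Finset.sum_insert hi, ← ih]
    simp

/-- The Christoffel form `Γ` of the connection in the chart `φ`, for which `∇ = d + Γ`: its value
`Γ x v w` is the expression in the chart of `∇_v W`, where `W` is the field that is constantly
`w` in the chart. Expanding `w` in a basis makes it bilinear at every point. -/
def christoffel (φ : OpenPartialHomeomorph M E) (x : E) : E →L[ℝ] E →L[ℝ] E :=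
  ∑ i, (ContinuousLinearMap.smulRightL ℝ E E
      (LinearMap.toContinuousLinearMap ((Module.finBasis ℝ E).coord i))).comp
    ((chartDeriv φ (φ.symm x)).comp
      ((cov (chartField φ fun _ => Module.finBasis ℝ E i) (φ.symm x)).comp
        (chartDeriv φ (φ.symm x)).inverse))

theorem christoffel_apply (φ : OpenPartialHomeomorph M E) (x v w : E) :
    christoffel cov φ x v w = ∑ i, (Module.finBasis ℝ E).repr w i •
      chartDeriv φ (φ.symm x) (nabla cov (chartField φ fun _ => v)
        (chartField φ fun _ => Module.finBasis ℝ E i) (φ.symm x)) := by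
  simp [christoffel, nabla, chartField_apply]

variable {cov} {φ : OpenPartialHomeomorph M E}
  (hφ : φ ∈ IsManifold.maximalAtlas 𝓘(ℝ, E) ∞ M)

include hφ in
/-- The expression of `∇` in a chart: `∇ = d + Γ`. -/
theorem chartDeriv_cov_chartField {g : E → E} {q : M} (hq : q ∈ φ.source)
    (hg : DifferentiableAt ℝ g (φ q)) (u : TangentSpace 𝓘(ℝ, E) q) :
    chartDeriv φ q (cov (chartField φ g) q u) =
      fderiv ℝ g (φ q) (chartDeriv φ q u) +
        christoffel cov φ (φ q) (chartDeriv φ q u) (g (φ q)) := by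
  have : CompleteSpace E := FiniteDimensional.complete ℝ E
  set b := Module.finBasis ℝ E
  let l : ∀ _ : Fin (Module.finrank ℝ E), E →L[ℝ] ℝ :=
    fun i => LinearMap.toContinuousLinearMap (b.coord i)
  have hl : ∀ i w, l i w = b.repr w i := fun _ _ => rfl
  have h1 : chartField φ g =
      fun x => ∑ i, ((l i ∘ g) ∘ φ) x • chartField φ (fun _ => b i) x := by
    funext x
    simp only [chartField_apply, Function.comp_apply, hl, ← map_smul, ← map_sum]
    rw [b.sum_repr]
  have hlg : ∀ i, DifferentiableAt ℝ (l i ∘ g) (φ q) := fun i =>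
    (l i).differentiableAt.comp _ hg
  rw [h1, cov_sum_smul cov Finset.univ (fun i => (hlg i).mdifferentiableAt.comp q
      ((mdifferentiable_of_mem_maximalAtlas hφ).mdifferentiableAt hq))
    (fun i => (smoothFieldOn_constField hφ (b i)).mdifferentiableAt φ.open_source hq) u,
    Finset.sum_add_distrib, map_add, add_comm]
  congr 1
  · rw [map_sum, ← b.sum_repr (fderiv ℝ g (φ q) (chartDeriv φ q u))]
    refine Finset.sum_congr rfl fun i _ => ?_
    rw [map_smul, chartDeriv_chartField hφ hq, mvfderiv_comp_chart hφ hq (hlg i),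
      fderiv_comp _ (l i).differentiableAt hg, ContinuousLinearMap.fderiv]
    rfl
  · rw [christoffel_apply, φ.left_inv hq, map_sum]
    refine Finset.sum_congr rfl fun i _ => ?_
    rw [map_smul, nabla, chartField_chartDeriv hφ hq]
    rfl

include hφ in
theorem chartDeriv_cov_constField {q : M} (hq : q ∈ φ.source) (w : E)
    (u : TangentSpace 𝓘(ℝ, E) q) :
    chartDeriv φ q (cov (chartField φ fun _ => w) q u) =
      christoffel cov φ (φ q) (chartDeriv φ q u) w := by
  rw [chartDeriv_cov_chartField hφ hq (differentiableAt_const w)]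
  simp

include hφ in
/-- Vanishing torsion makes the Christoffel form symmetric. -/
theorem christoffel_symm (htors : ∀ x, ∀ u v, cov.torsion x u v = 0) {x : E} (hx : x ∈ φ.target)
    (u v : E) : christoffel cov φ x u v = christoffel cov φ x v u := by
  have : CompleteSpace E := FiniteDimensional.complete ℝ E
  have hq := φ.map_target hx
  have h := cov.torsion_apply
    ((smoothFieldOn_constField hφ u).mdifferentiableAt φ.open_source hq)
    ((smoothFieldOn_constField hφ v).mdifferentiableAt φ.open_source hq)
  rw [htors, mlieBracket_constField hφ hq, sub_zero] at h
  have h2 := congrArg (chartDeriv φ (φ.symm x)) h.symm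
  rw [map_sub, map_zero, chartDeriv_cov_constField hφ hq, chartDeriv_cov_constField hφ hq,
    chartDeriv_chartField hφ hq, chartDeriv_chartField hφ hq, φ.right_inv hx] at h2
  exact sub_eq_zero.1 h2

variable [T2Space M] (hcov : cov.ContMDiffCovariantDerivative ∞)

include hφ hcov in
theorem contDiffOn_christoffel : ContDiffOn ℝ ∞ (christoffel cov φ) φ.target := by
  have : CompleteSpace E := FiniteDimensional.complete ℝ E
  refine contDiffOn_clm_apply.2 fun v => contDiffOn_clm_apply.2 fun w => ?_
  simp only [christoffel_apply]
  exact ContDiffOn.sum fun i _ => contDiffOn_const.smul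
    (contDiffOn_chartDeriv hφ ((smoothFieldOn_constField hφ v).nabla hcov φ.open_source
      (smoothFieldOn_constField hφ _)))

include hφ hcov in
/-- Vanishing curvature is the integrability condition `dΓ + Γ ∧ Γ = 0`. -/
theorem christoffel_flat (hflat : IsFlat cov) {x : E} (hx : x ∈ φ.target) (u v w : E) :
    fderiv ℝ (christoffel cov φ) x u v w +
        christoffel cov φ x u (christoffel cov φ x v w) =
      fderiv ℝ (christoffel cov φ) x v u w +
        christoffel cov φ x v (christoffel cov φ x u w) := by
  have : CompleteSpace E := FiniteDimensional.complete ℝ E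
  have hq := φ.map_target hx
  have hW := fun c => smoothFieldOn_constField hφ c
  have hΓ : DifferentiableAt ℝ (christoffel cov φ) x :=
    ((contDiffOn_christoffel hφ hcov).contDiffAt (φ.open_target.mem_nhds hx)).differentiableAt
      (by simp)
  have hs : ∀ v : E, ContDiffOn ℝ ∞ (fun y => christoffel cov φ y v w) φ.target := fun v =>
    ((contDiffOn_christoffel hφ hcov).clm_apply contDiffOn_const).clm_apply contDiffOn_const
  -- the second covariant derivatives of the constant fields
  have key : ∀ u v : E, chartDeriv φ (φ.symm x)
      (nabla cov (chartField φ fun _ => u) (nabla cov (chartField φ fun _ => v)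
        (chartField φ fun _ => w)) (φ.symm x)) =
      fderiv ℝ (christoffel cov φ) x u v w +
        christoffel cov φ x u (christoffel cov φ x v w) := by
    intro u v
    have h1 : cov (nabla cov (chartField φ fun _ => v) (chartField φ fun _ => w)) (φ.symm x) =
        cov (chartField φ fun y => christoffel cov φ y v w) (φ.symm x) := by
      refine cov_congr cov ((hW v).nabla hcov φ.open_source (hW w)) φ.open_source
        (smoothFieldOn_chartField hφ φ.open_target (hs v))
        (φ.isOpen_inter_preimage φ.open_target) hq ⟨hq, φ.map_source hq⟩ ?_
      filter_upwards [φ.open_source.mem_nhds hq] with z hz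
      rw [← chartField_chartDeriv hφ hz (nabla _ _ _ z), nabla,
        chartDeriv_cov_constField hφ hz, chartDeriv_chartField hφ hz]
      rfl
    rw [nabla, h1, chartDeriv_cov_chartField hφ hq, chartDeriv_chartField hφ hq, φ.right_inv hx]
    · congr 1
      have h2 := (hΓ.hasFDerivAt.clm_apply (hasFDerivAt_const v x)).clm_apply
        (hasFDerivAt_const w x)
      rw [h2.fderiv]
      simp
    · exact ((hs v).contDiffAt (φ.open_target.mem_nhds (φ.map_source hq))).differentiableAt
        (by simp)
  have h := hflat.curvature_eq_zero hcov φ.open_source (hW u) (hW v) (hW w) hq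
  have h2 := congrArg (chartDeriv φ (φ.symm x)) h
  simp only [curvature, Pi.sub_apply] at h2
  rw [map_sub, map_sub, key, key, map_zero] at h2
  rw [nabla, mlieBracket_constField hφ hq, map_zero, map_zero, sub_zero] at h2
  exact sub_eq_zero.1 h2

end Christoffel

/-! ### Flat charts of a manifold -/

section FlatChart

variable {E : Type*} [NormedAddCommGroup E] [NormedSpace ℝ E] [FiniteDimensional ℝ E]
  {M : Type*} [TopologicalSpace M] [T2Space M] [ChartedSpace E M] [IsManifold 𝓘(ℝ, E) ∞ M]
  {cov : CovariantDerivative 𝓘(ℝ, E) E (TangentSpace 𝓘(ℝ, E) : M → Type _)}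

/-- A flat torsion-free connection has charts with prescribed differential at a point in which all
constant vector fields are parallel. -/
theorem exists_flat_chart (hcov : cov.ContMDiffCovariantDerivative ∞) (hflat : IsFlat cov)
    (htors : ∀ x, ∀ u v, cov.torsion x u v = 0) (p : M) (ℓ : TangentSpace 𝓘(ℝ, E) p ≃L[ℝ] E) :
    ∃ φ ∈ IsManifold.maximalAtlas 𝓘(ℝ, E) ∞ M, p ∈ φ.source ∧ Convex ℝ φ.target ∧
      chartDeriv φ p = ℓ ∧ ∀ c, ∀ q ∈ φ.source, cov (chartField φ fun _ => c) q = 0 := by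
  have : CompleteSpace E := FiniteDimensional.complete ℝ E
  set ψ := chartAt E p
  have hψ : ψ ∈ IsManifold.maximalAtlas 𝓘(ℝ, E) ∞ M :=
    IsManifold.chart_mem_maximalAtlas (I := 𝓘(ℝ, E)) (n := ∞) p
  have hp : p ∈ ψ.source := mem_chart_source E p
  obtain ⟨A, hA⟩ := isInvertible_chartDeriv hψ hp
  obtain ⟨e, hes, hpe, hconv, he, he', a, ha₀, ha⟩ := exists_affine_chart ψ.open_target
    (ψ.map_source hp) (contDiffOn_christoffel hψ hcov)
    (fun x hx => christoffel_symm hψ htors hx)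
    (fun x hx => christoffel_flat hψ hcov hflat hx) (A.symm.trans ℓ)
  set φ := ψ.trans e
  have hsrc : ∀ q ∈ φ.source, ψ q ∈ e.source := fun q hq => hq.2
  have htgt : φ.target = e.target := by
    ext y
    exact ⟨fun hy => hy.1, fun hy => ⟨hy, hes (e.map_target hy)⟩⟩
  have hφ : φ ∈ IsManifold.maximalAtlas 𝓘(ℝ, E) ∞ M := by
    refine OpenPartialHomeomorph.mem_maximalAtlas_of_contMDiffOn φ ?_ ?_
    · exact (contMDiffOn_iff_contDiffOn.2 he).comp
        ((contMDiffOn_of_mem_maximalAtlas hψ).mono fun q hq => hq.1) fun q hq => hq.2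
    · rw [htgt]
      exact (contMDiffOn_symm_of_mem_maximalAtlas hψ).comp (contMDiffOn_iff_contDiffOn.2 he')
        fun y hy => hes (e.map_target hy)
  have hd : ∀ q ∈ φ.source, chartDeriv φ q = (a (ψ q)).comp (chartDeriv ψ q) := by
    intro q hq
    have h1 : mfderiv 𝓘(ℝ, E) 𝓘(ℝ, E) e (ψ q) = a (ψ q) := by
      rw [mfderiv_eq_fderiv]
      exact (ha _ (hsrc q hq)).2.1.fderiv
    rw [chartDeriv, chartDeriv, ← h1]
    exact mfderiv_comp q (ha _ (hsrc q hq)).2.1.differentiableAt.mdifferentiableAt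
      ((mdifferentiable_of_mem_maximalAtlas hψ).mdifferentiableAt hq.1)
  refine ⟨φ, hφ, ⟨hp, hpe⟩, htgt ▸ hconv, ?_, fun c q hq => ?_⟩
  · rw [hd p ⟨hp, hpe⟩, ha₀, ← hA]
    ext u
    simp
  · -- the field that is constantly `c` in `φ` has the expression `y ↦ (a y)⁻¹ c` in `ψ`
    have hcf : ∀ z ∈ φ.source, chartField φ (fun _ => c) z =
        chartField ψ (fun y => (a y).inverse c) z := by
      intro z hz
      rw [← chartField_chartDeriv hψ hz.1 (chartField φ _ z), chartField_apply, chartField_apply]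
      congr 1
      obtain ⟨B, hB⟩ := (ha _ (hsrc z hz)).1
      change chartDeriv ψ z ((chartDeriv φ z).inverse c) = (a (ψ z)).inverse c
      rw [← hB, ContinuousLinearMap.inverse_equiv]
      apply B.injective
      have h2 := chartDeriv_chartField hφ hz fun _ => c
      rw [hd z hz, ContinuousLinearMap.comp_apply, ← hB] at h2
      refine Eq.trans ?_ (B.apply_symm_apply c).symm
      exact h2
    have h1 : cov (chartField φ fun _ => c) q =
        cov (chartField ψ fun y => (a y).inverse c) q := by
      have hs := smoothFieldOn_constField hφ c
      refine cov_congr cov hs φ.open_source (V := φ.source)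
        (ContMDiffOn.congr hs fun z hz => ?_) φ.open_source hq hq ?_
      · rw [hcf z hz]
      · filter_upwards [φ.open_source.mem_nhds hq] with z hz using hcf z hz
    ext u
    apply (show Function.Injective (chartDeriv ψ q) by
      obtain ⟨B, hB⟩ := isInvertible_chartDeriv hψ hq.1
      rw [← hB]; exact B.injective)
    rw [h1, chartDeriv_cov_chartField hψ hq.1 ((ha _ (hsrc q hq)).2.2 c).differentiableAt,
      ((ha _ (hsrc q hq)).2.2 c).fderiv]
    simp

end FlatChart

/-! ### Matrices of smooth functions -/

section Matrices

variable {E : Type*} [NormedAddCommGroup E] [NormedSpace ℝ E]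
  {M : Type*} [TopologicalSpace M] [ChartedSpace E M] {U : Set M}
  {ι : Type*} [Fintype ι] [DecidableEq ι] {A : M → Matrix ι ι ℝ}

theorem contMDiffOn_det (hA : ∀ i j, ContMDiffOn 𝓘(ℝ, E) 𝓘(ℝ) ∞ (fun x => A x i j) U) :
    ContMDiffOn 𝓘(ℝ, E) 𝓘(ℝ) ∞ (fun x => (A x).det) U := by
  simp only [Matrix.det_apply']
  exact contMDiffOn_finsetSum fun σ _ => contMDiffOn_const.mul
    (contMDiffOn_finsetProd fun i _ => hA _ _)

theorem contMDiffOn_matrix_inv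
    (hA : ∀ i j, ContMDiffOn 𝓘(ℝ, E) 𝓘(ℝ) ∞ (fun x => A x i j) U)
    (hu : ∀ x ∈ U, IsUnit (A x)) (i j : ι) :
    ContMDiffOn 𝓘(ℝ, E) 𝓘(ℝ) ∞ (fun x => (A x)⁻¹ i j) U := by
  have h0 : ∀ x ∈ U, (A x).det ≠ 0 := fun x hx =>
    ((Matrix.isUnit_iff_isUnit_det _).1 (hu x hx)).ne_zero
  simp only [Matrix.inv_def, Matrix.smul_apply, smul_eq_mul, Ring.inverse_eq_inv']
  refine ((contMDiffOn_det hA).inv₀ h0).mul ?_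
  simp only [Matrix.adjugate_apply]
  refine contMDiffOn_det fun a b => ?_
  simp only [Matrix.updateRow_apply]
  split_ifs
  · exact contMDiffOn_const
  · exact hA a b

end Matrices

/-! ### Adapted frames -/

section AdaptedFrame

variable {E : Type*} [NormedAddCommGroup E] [NormedSpace ℝ E]
  {M : Type*} [TopologicalSpace M] [ChartedSpace E M] [IsManifold 𝓘(ℝ, E) ∞ M]
  {n k : ℕ} {Ω : Fin k → BilinForm 𝓘(ℝ, E) M} {L Q : Distribution 𝓘(ℝ, E) M}

theorem IsTwoForm.neg_swap {Ω : BilinForm 𝓘(ℝ, E) M} (h : IsTwoForm Ω) {x : M}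
    (u v : TangentSpace 𝓘(ℝ, E) x) : Ω x u v = -Ω x v u := by
  have h1 := h.alternating x (u + v)
  simp only [map_add, _root_.add_apply, h.alternating] at h1
  linarith

theorem IsKSymplectic.eq_zero (hM : IsKSymplectic n k Ω L) {x : M} {v : TangentSpace 𝓘(ℝ, E) x}
    (h : ∀ α w, Ω α x v w = 0) : v = 0 := by
  have : v ∈ (⨅ α, charSpace (Ω α) x) := by
    simp only [Submodule.mem_iInf, charSpace, LinearMap.mem_ker]
    exact fun α => ContinuousLinearMap.ext (h α)
  rwa [hM.nondegenerate, Submodule.mem_bot] at this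

theorem exists_add_of_isCompl {R V : Type*} [Ring R] [AddCommGroup V] [Module R V]
    {p q : Submodule R V} (h : IsCompl p q) (v : V) : ∃ a ∈ p, ∃ b ∈ q, a + b = v :=
  Submodule.mem_sup.1 (h.sup_eq_top ▸ Submodule.mem_top)

/-- `y` and `e` are smooth local frames of `Q` and `L` over the open set `U`, dual to each other:
`Ω_β(y_j, e_{αi}) = δ_{αβ} δ_{ij}`. -/
structure IsAdaptedFrame (Ω : Fin k → BilinForm 𝓘(ℝ, E) M) (L Q : Distribution 𝓘(ℝ, E) M)
    (U : Set M) (y : Fin n → VField 𝓘(ℝ, E) M) (e : Fin k → Fin n → VField 𝓘(ℝ, E) M) :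
    Prop where
  isOpen : IsOpen U
  smooth_y : ∀ i, SmoothFieldOn (y i) U
  smooth_e : ∀ α i, SmoothFieldOn (e α i) U
  span_y : ∀ x ∈ U, Submodule.span ℝ (range fun i => y i x) = Q x
  e_mem : ∀ α i, ∀ x ∈ U, e α i x ∈ L x
  dual : ∀ α β i j, ∀ x ∈ U, Ω β x (y j x) (e α i x) = if (α, i) = (β, j) then 1 else 0

/-- The pairing of `L` with `Q` under the forms is nondegenerate on the side of `L`. -/
theorem eq_zero_of_mem_of_span (hM : IsKSymplectic n k Ω L) (hQ : IsAdmissible n Ω L Q) {x : M}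
    {ι : Type*} {y : ι → TangentSpace 𝓘(ℝ, E) x} (hy : Submodule.span ℝ (range y) = Q x)
    {v : TangentSpace 𝓘(ℝ, E) x} (hv : v ∈ L x) (h : ∀ β i, Ω β x (y i) v = 0) : v = 0 := by
  refine hM.eq_zero fun β w => ?_
  obtain ⟨a, ha, b, hb, rfl⟩ := exists_add_of_isCompl (hQ.transversal x) w
  have : Q x ≤ LinearMap.ker (Ω β x v).toLinearMap := by
    rw [← hy, Submodule.span_le]
    rintro _ ⟨i, rfl⟩
    change Ω β x v (y i) = 0
    rw [(hM.form β).neg_swap, h, neg_zero]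
  rw [map_add, hM.isotropic β x v hv a ha, zero_add]
  exact this hb

/-- The matrix of the pairings `Ω_β(y_i, s_a)` of arbitrary local frames `y` of `Q` and `s` of `L`
is square and, by nondegeneracy, invertible. Its inverse turns `s` into the frame dual to `y`. -/
theorem exists_isAdaptedFrame (hM : IsKSymplectic n k Ω L) (hQ : IsAdmissible n Ω L Q) (p : M) :
    ∃ U : Set M, p ∈ U ∧ ∃ y e, IsAdaptedFrame (n := n) Ω L Q U y e := by
  obtain ⟨U₁, hU₁, hp₁, s, hs, hsp⟩ := hM.foliation.smooth p
  obtain ⟨U₂, hU₂, hp₂, y, hy, hyp⟩ := hQ.integrable.smooth p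
  set U := U₁ ∩ U₂
  let σ : Fin k × Fin n ≃ Fin (n * k) := Fintype.equivOfCardEq (by simp [mul_comm])
  let N : M → Matrix (Fin k × Fin n) (Fin k × Fin n) ℝ :=
    fun x => .of fun a b => Ω b.1 x (y b.2 x) (s (σ a) x)
  have hN : ∀ a b, ContMDiffOn 𝓘(ℝ, E) 𝓘(ℝ) ∞ (fun x => N x a b) U := fun a b =>
    (hM.form b.1).contMDiffOn_evalForm ((hy b.2).mono inter_subset_right)
      ((hs (σ a)).mono inter_subset_left)
  have hu : ∀ x ∈ U, IsUnit (N x) := by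
    intro x hx
    rw [← Matrix.vecMul_injective_iff_isUnit]
    refine (injective_iff_map_eq_zero (Matrix.vecMulLinear (N x))).2 fun c hc => ?_
    have hsL : ∀ a, s a x ∈ L x := fun a =>
      (hsp x hx.1).2 ▸ Submodule.subset_span (mem_range_self a)
    have h0 : ∑ a, c a • s (σ a) x = 0 := by
      refine eq_zero_of_mem_of_span hM hQ (hyp x hx.2).2
        (Submodule.sum_mem _ fun a _ => Submodule.smul_mem _ _ (hsL _)) fun β i => ?_
      have := congrFun hc (β, i)
      simpa [Matrix.vecMulLinear, Matrix.vecMul, dotProduct, N] using this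
    have hli := ((hsp x hx.1).1.comp σ σ.injective)
    exact funext (Fintype.linearIndependent_iff.1 hli c h0)
  refine ⟨U, ⟨hp₁, hp₂⟩, y, fun α i x => ∑ a, (N x)⁻¹ (α, i) a • s (σ a) x, hU₁.inter hU₂,
    fun i => (hy i).mono inter_subset_right, fun α i => ?_, fun x hx => (hyp x hx.2).2,
    fun α i x hx => ?_, fun α β i j x hx => ?_⟩
  · exact SmoothFieldOn.sum fun a _ => SmoothFieldOn.smul
      (contMDiffOn_matrix_inv hN hu (α, i) a) ((hs (σ a)).mono inter_subset_left)
  · refine Submodule.sum_mem _ fun a _ => Submodule.smul_mem _ _ ?_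
    rw [← (hsp x hx.1).2]
    exact Submodule.subset_span (mem_range_self _)
  · have h1 := Matrix.nonsing_inv_mul (N x) ((Matrix.isUnit_iff_isUnit_det _).1 (hu x hx))
    have h2 := congrFun (congrFun h1 (α, i)) (β, j)
    rw [Matrix.mul_apply, Matrix.one_apply] at h2
    rw [← h2, map_sum]
    simp [N]

namespace IsAdaptedFrame

variable {U : Set M} {y : Fin n → VField 𝓘(ℝ, E) M} {e : Fin k → Fin n → VField 𝓘(ℝ, E) M}
  (h : IsAdaptedFrame Ω L Q U y e) (hM : IsKSymplectic n k Ω L) (hQ : IsAdmissible n Ω L Q)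
  {x : M} (hx : x ∈ U)
include h hx

theorem y_mem (i : Fin n) : y i x ∈ Q x :=
  h.span_y x hx ▸ Submodule.subset_span (mem_range_self i)

include hM hQ

/-- The expansion of a vector of `L` in an adapted frame. -/
theorem sum_smul_eq {u : TangentSpace 𝓘(ℝ, E) x} (hu : u ∈ L x) :
    ∑ a : Fin k × Fin n, Ω a.1 x (y a.2 x) u • e a.1 a.2 x = u := by
  refine sub_eq_zero.1 (eq_zero_of_mem_of_span hM hQ (h.span_y x hx) (Submodule.sub_mem _
    (Submodule.sum_mem _ fun a _ => Submodule.smul_mem _ _ (h.e_mem _ _ x hx)) hu) fun β j => ?_)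
  rw [map_sub, map_sum]
  simp [h.dual _ _ _ _ x hx, -Prod.mk.injEq]

theorem e_mem_subBundle (α : Fin k) (i : Fin n) : e α i x ∈ subBundle Ω L α x := by
  refine ⟨h.e_mem α i x hx, ?_⟩
  simp only [SetLike.mem_coe, Submodule.mem_iInf, charSpace, LinearMap.mem_ker]
  intro β hβ
  refine ContinuousLinearMap.ext fun w => ?_
  obtain ⟨a, ha, b, hb, rfl⟩ := exists_add_of_isCompl (hQ.transversal x) w
  have : Q x ≤ LinearMap.ker (Ω β x (e α i x)).toLinearMap := by
    rw [← h.span_y x hx, Submodule.span_le]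
    rintro _ ⟨j, rfl⟩
    change Ω β x (e α i x) (y j x) = 0
    rw [(hM.form β).neg_swap, h.dual _ _ _ _ x hx, if_neg (by simp [hβ.symm]), neg_zero]
  change Ω β x (e α i x) (a + b) = 0
  rw [map_add, hM.isotropic β x _ (h.e_mem α i x hx) a ha, zero_add]
  exact this hb

end IsAdaptedFrame

/-- The canonical connection preserves `L`, since `L` is spanned by the sections `e_{αi}` of the
subbundles `L_α`. -/
theorem preserves_leaves [FiniteDimensional ℝ E] [CompleteSpace E] [T2Space M]
    {cov : CovariantDerivative 𝓘(ℝ, E) E (TangentSpace 𝓘(ℝ, E) : M → Type _)}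
    (hM : IsKSymplectic n k Ω L) (hQ : IsAdmissible n Ω L Q)
    (hcov : IsCanonicalConnection Ω L Q cov) : Preserves cov L := by
  intro V X hV hX x
  obtain ⟨U, hx, y, e, h⟩ := exists_isAdaptedFrame hM hQ x
  have hf : ∀ a : Fin k × Fin n, ContMDiffOn 𝓘(ℝ, E) 𝓘(ℝ) ∞ (evalForm (Ω a.1) (y a.2) X) U :=
    fun a => (hM.form a.1).contMDiffOn_evalForm (h.smooth_y a.2) (hX.1.smoothFieldOn U)
  have hfe : ∀ a : Fin k × Fin n,
      SmoothFieldOn (fun z => evalForm (Ω a.1) (y a.2) X z • e a.1 a.2 z) U := fun a =>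
    SmoothFieldOn.smul (hf a) (h.smooth_e a.1 a.2)
  have h1 : cov X x = cov (fun z => ∑ a : Fin k × Fin n,
      evalForm (Ω a.1) (y a.2) X z • e a.1 a.2 z) x := by
    refine cov_congr cov hX.1 isOpen_univ (SmoothFieldOn.sum fun a _ => hfe a) h.isOpen
      (mem_univ x) hx ?_
    filter_upwards [h.isOpen.mem_nhds hx] with z hz
    exact (h.sum_smul_eq hM hQ hz (hX.2 z)).symm
  rw [nabla, h1, cov_sum_smul cov Finset.univ
    (fun a => ((hf a).contMDiffAt (h.isOpen.mem_nhds hx)).mdifferentiableAt (by simp))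
    (fun a => (h.smooth_e a.1 a.2).mdifferentiableAt h.isOpen hx)]
  refine Submodule.sum_mem _ fun a _ => Submodule.add_mem _ (Submodule.smul_mem _ _ ?_)
    (Submodule.smul_mem _ _ (h.e_mem _ _ x hx))
  exact ((hcov.preserves_subBundle a.1).cov_mem h.isOpen (h.smooth_e a.1 a.2)
    (fun z hz => h.e_mem_subBundle hM hQ hz _ _) hx _).1

end AdaptedFrame

/-! ### Torsion of the canonical connection -/

section Torsion

variable {E : Type*} [NormedAddCommGroup E] [NormedSpace ℝ E] [FiniteDimensional ℝ E]
  {M : Type*} [TopologicalSpace M] [T2Space M] [ChartedSpace E M]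
  [IsManifold 𝓘(ℝ, E) ∞ M]
  {cov : CovariantDerivative 𝓘(ℝ, E) E (TangentSpace 𝓘(ℝ, E) : M → Type _)}

theorem IsSmoothDistribution.exists_isSection_apply_eq {D : Distribution 𝓘(ℝ, E) M} {r : ℕ}
    (hD : IsSmoothDistribution D r) {q : M} {u : TangentSpace 𝓘(ℝ, E) q} (hu : u ∈ D q) :
    ∃ X, IsSection D X ∧ X q = u := by
  obtain ⟨U, hU, hq, s, hs, hsp⟩ := hD q
  rw [← (hsp q hq).2, Submodule.mem_span_range_iff_exists_fun] at hu
  obtain ⟨c, rfl⟩ := hu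
  obtain ⟨X, hX, he⟩ := exists_isSection (D := D) (X := fun x => ∑ i, c i • s i x) hU
    (SmoothFieldOn.sum fun i _ => SmoothFieldOn.smul (f := fun _ => c i) contMDiffOn_const (hs i))
    (fun x hx => Submodule.sum_mem _ fun i _ => Submodule.smul_mem _ _
      ((hsp x hx).2 ▸ Submodule.subset_span (mem_range_self i))) hq
  exact ⟨X, hX, he.self_of_nhds⟩

omit [T2Space M] in
theorem torsion_apply_smoothField [CompleteSpace E] {X Y : VField 𝓘(ℝ, E) M}
    (hX : SmoothField X) (hY : SmoothField Y) (q : M) :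
    cov.torsion q (X q) (Y q) = cov Y q (X q) - cov X q (Y q) - mlieBracket 𝓘(ℝ, E) X Y q :=
  cov.torsion_apply (SmoothFieldOn.mdifferentiableAt hX isOpen_univ (mem_univ q))
    (SmoothFieldOn.mdifferentiableAt hY isOpen_univ (mem_univ q))

/-- On an integrable distribution preserved by the connection, the torsion takes values in the
distribution. -/
theorem IsFoliation.torsion_mem [CompleteSpace E] {D : Distribution 𝓘(ℝ, E) M} {r : ℕ}
    (hD : IsFoliation D r) (hcov : Preserves cov D) {q : M} {u v : TangentSpace 𝓘(ℝ, E) q}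
    (hu : u ∈ D q) (hv : v ∈ D q) : cov.torsion q u v ∈ D q := by
  obtain ⟨X, hX, rfl⟩ := hD.smooth.exists_isSection_apply_eq hu
  obtain ⟨Y, hY, rfl⟩ := hD.smooth.exists_isSection_apply_eq hv
  rw [torsion_apply_smoothField hX.1 hY.1]
  exact Submodule.sub_mem _ (Submodule.sub_mem _ (hcov X Y hX.1 hY q) (hcov Y X hY.1 hX q))
    (hD.involutive X Y hX hY q)

/-- The Bianchi-type identity for a closed form that is parallel for a connection with torsion. -/
theorem IsClosedForm.sum_torsion_eq_zero [CompleteSpace E] {Ω : BilinForm 𝓘(ℝ, E) M}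
    (hΩ : IsTwoForm Ω) (hc : IsClosedForm Ω) (hp : IsParallelForm cov Ω) {q : M}
    (u v w : TangentSpace 𝓘(ℝ, E) q) :
    Ω q (cov.torsion q u v) w - Ω q (cov.torsion q u w) v + Ω q (cov.torsion q v w) u = 0 := by
  obtain ⟨X, hX, rfl⟩ := exists_smoothField_apply_eq u
  obtain ⟨Y, hY, rfl⟩ := exists_smoothField_apply_eq v
  obtain ⟨Z, hZ, rfl⟩ := exists_smoothField_apply_eq w
  have h := hc X Y Z hX hY hZ q
  rw [extDerivTwo, dirDeriv, dirDeriv, dirDeriv,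
    hp.mvfderiv_evalForm isOpen_univ hY hZ (mem_univ q),
    hp.mvfderiv_evalForm isOpen_univ hX hZ (mem_univ q),
    hp.mvfderiv_evalForm isOpen_univ hX hY (mem_univ q)] at h
  simp only [torsion_apply_smoothField hX hY, torsion_apply_smoothField hX hZ,
    torsion_apply_smoothField hY hZ, map_sub, _root_.sub_apply]
  rw [hΩ.neg_swap (Y q), hΩ.neg_swap (X q) (cov Z q (Y q)),
    hΩ.neg_swap (X q) (cov Y q (Z q))] at h
  linarith

/-- The canonical connection is torsion-free. For `u, v ∈ L` the vector `T(u, v)` lies in the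
isotropic `L`, and `Ω_α(T(u, v), w) = 0` for `w ∈ Q` because `dΩ_α = 0` and the mixed torsion
vanishes; the same argument applies to `Q`. -/
theorem torsion_eq_zero [CompleteSpace E] {n k : ℕ} {Ω : Fin k → BilinForm 𝓘(ℝ, E) M}
    {L Q : Distribution 𝓘(ℝ, E) M} (hM : IsKSymplectic n k Ω L) (hQ : IsAdmissible n Ω L Q)
    (hcov : IsCanonicalConnection Ω L Q cov) (q : M) (u v : TangentSpace 𝓘(ℝ, E) q) :
    cov.torsion q u v = 0 := by
  -- one statement for the pairs `(L, Q)` and `(Q, L)`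
  have key : ∀ {D D' : Distribution 𝓘(ℝ, E) M} {r : ℕ}, IsFoliation D r → Preserves cov D →
      (∀ α, ∀ u ∈ D q, ∀ v ∈ D q, Ω α q u v = 0) → IsCompl (D q) (D' q) →
      (∀ u ∈ D q, ∀ v ∈ D' q, cov.torsion q u v = 0) →
      ∀ u ∈ D q, ∀ v ∈ D q, cov.torsion q u v = 0 := by
    intro D D' r hD hpres hiso hcompl hmix u hu v hv
    refine hM.eq_zero fun α w => ?_
    obtain ⟨a, ha, b, hb, rfl⟩ := exists_add_of_isCompl hcompl w
    have h := (hM.closed α).sum_torsion_eq_zero (hM.form α) (hcov.parallel α) u v b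
    rw [hmix u hu b hb, hmix v hv b hb] at h
    rw [map_add, hiso α _ (hD.torsion_mem hpres hu hv) a ha]
    simpa using h
  have hLQ := hcov.torsion q
  have hQL : ∀ u ∈ Q q, ∀ v ∈ L q, cov.torsion q u v = 0 := fun u hu v hv => by
    rw [cov.torsion_antisymm, hLQ v hv u hu, neg_zero]
  have hLL := key hM.foliation (preserves_leaves hM hQ hcov) (fun α => hM.isotropic α q)
    (hQ.transversal q) hLQ
  have hQQ := key hQ.integrable hcov.preserves_transversal (fun α => hQ.isotropic α q)
    (hQ.transversal q).symm hQL
  obtain ⟨a, ha, b, hb, rfl⟩ := exists_add_of_isCompl (hQ.transversal q) u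
  obtain ⟨a', ha', b', hb', rfl⟩ := exists_add_of_isCompl (hQ.transversal q) v
  simp [hLL a ha a' ha', hLQ a ha b' hb', hQL b hb a' ha', hQQ b hb b' hb']

end Torsion

/-! ### Parallel fields in a flat chart -/

section FlatCharts

variable {E : Type*} [NormedAddCommGroup E] [NormedSpace ℝ E]
  {M : Type*} [TopologicalSpace M] [ChartedSpace E M]
  {φ : OpenPartialHomeomorph M E} (hφ : φ ∈ IsManifold.maximalAtlas 𝓘(ℝ, E) ∞ M)

include hφ in
theorem eq_of_mvfderiv_eq_zero (hconv : Convex ℝ φ.target) {f : M → ℝ}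
    (hf : ContMDiffOn 𝓘(ℝ, E) 𝓘(ℝ) ∞ f φ.source)
    (hz : ∀ q ∈ φ.source, ∀ u, mvfderiv 𝓘(ℝ, E) f q u = 0) {p q : M} (hp : p ∈ φ.source)
    (hq : q ∈ φ.source) : f q = f p := by
  have h1 : ContDiffOn ℝ ∞ (f ∘ φ.symm) φ.target := contMDiffOn_iff_contDiffOn.1
    (hf.comp (contMDiffOn_symm_of_mem_maximalAtlas hφ) fun y hy => φ.map_target hy)
  have h2 : ∀ x ∈ φ.target, fderiv ℝ (f ∘ φ.symm) x = 0 := by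
    intro x hx
    have hx' := φ.map_target hx
    ext c
    rw [_root_.zero_apply, ← φ.right_inv hx, ← chartDeriv_chartField hφ hx' fun _ => c,
      ← mvfderiv_comp_chart hφ hx' ?_, mvfderiv_congr (g := f)]
    · exact hz _ hx' _
    · filter_upwards [φ.open_source.mem_nhds hx'] with z hz
      simp [φ.left_inv hz]
    · rw [φ.right_inv hx]
      exact (h1.contDiffAt (φ.open_target.mem_nhds hx)).differentiableAt (by simp)
  have h3 := φ.open_target.is_const_of_fderiv_eq_zero hconv.isPreconnected
    (h1.differentiableOn (by simp)) h2 (φ.map_source hq) (φ.map_source hp)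
  simpa [φ.left_inv hp, φ.left_inv hq] using h3

include hφ in
theorem hasDerivWithinAt_comp_chart {γ : ℝ → M} {s : Set ℝ} {t : ℝ}
    (hγ : MDifferentiableWithinAt 𝓘(ℝ, ℝ) 𝓘(ℝ, E) γ s t) (ht : γ t ∈ φ.source) :
    HasDerivWithinAt (φ ∘ γ)
      (chartDeriv φ (γ t) (mfderivWithin 𝓘(ℝ, ℝ) 𝓘(ℝ, E) γ s t (1 : ℝ))) s t := by
  have h1 := ((mdifferentiable_of_mem_maximalAtlas hφ).mdifferentiableAt ht).hasMFDerivAt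
  have h2 := h1.comp_hasMFDerivWithinAt t hγ.hasMFDerivWithinAt
  let T : ℝ →L[ℝ] E := (chartDeriv φ (γ t)).comp (mfderivWithin 𝓘(ℝ, ℝ) 𝓘(ℝ, E) γ s t)
  have h3 : HasFDerivWithinAt (φ ∘ γ) T s t := hasMFDerivWithinAt_iff_hasFDerivWithinAt.1 h2
  exact h3.hasDerivWithinAt

variable [IsManifold 𝓘(ℝ, E) ∞ M] [FiniteDimensional ℝ E] [CompleteSpace E] [T2Space M]
  {cov : CovariantDerivative 𝓘(ℝ, E) E (TangentSpace 𝓘(ℝ, E) : M → Type _)}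
  {n k : ℕ} {Ω : Fin k → BilinForm 𝓘(ℝ, E) M} {L Q : Distribution 𝓘(ℝ, E) M}

omit [CompleteSpace E] in
include hφ in
theorem evalForm_eq_of_parallel {η : BilinForm 𝓘(ℝ, E) M} (hη : IsTwoForm η)
    (hpar : IsParallelForm cov η) (hconv : Convex ℝ φ.target) {X Y : VField 𝓘(ℝ, E) M}
    (hX : SmoothFieldOn X φ.source) (hY : SmoothFieldOn Y φ.source)
    (hX0 : ∀ q ∈ φ.source, cov X q = 0) (hY0 : ∀ q ∈ φ.source, cov Y q = 0) {p q : M}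
    (hp : p ∈ φ.source) (hq : q ∈ φ.source) : η q (X q) (Y q) = η p (X p) (Y p) := by
  refine eq_of_mvfderiv_eq_zero hφ hconv (hη.contMDiffOn_evalForm hX hY) (fun z hz u => ?_) hp hq
  rw [hpar.mvfderiv_evalForm φ.open_source hX hY hz, hX0 z hz, hY0 z hz]
  simp

include hφ in
/-- In a flat chart a parallel field that vanishes at one point vanishes identically: its pairings
with the constant fields under the `Ω_α` are constant. -/
theorem eq_zero_of_parallel (hM : IsKSymplectic n k Ω L) (hpar : ∀ α, IsParallelForm cov (Ω α))
    (hconv : Convex ℝ φ.target) (hflat : ∀ c, ∀ q ∈ φ.source, cov (chartField φ fun _ => c) q = 0)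
    {Z : VField 𝓘(ℝ, E) M} (hZ : SmoothFieldOn Z φ.source) (hZ0 : ∀ q ∈ φ.source, cov Z q = 0)
    {p q : M} (hp : p ∈ φ.source) (hZp : Z p = 0) (hq : q ∈ φ.source) : Z q = 0 := by
  refine hM.eq_zero fun α w => ?_
  rw [← chartField_chartDeriv hφ hq w, evalForm_eq_of_parallel hφ (hM.form α) (hpar α) hconv hZ
    (smoothFieldOn_constField hφ _) hZ0 (hflat _) hp hq, hZp]
  simp

omit [FiniteDimensional ℝ E] [CompleteSpace E] [T2Space M] in
/-- The component of a smooth field along `L` is smooth: in an adapted frame it is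
`∑ Ω_α(y_i, X) e_{αi}`. -/
theorem exists_smooth_decomposition (hM : IsKSymplectic n k Ω L) (hQ : IsAdmissible n Ω L Q)
    {U : Set M} {X : VField 𝓘(ℝ, E) M} (hX : SmoothFieldOn X U) (hU : IsOpen U) :
    ∃ Z : VField 𝓘(ℝ, E) M, SmoothFieldOn Z U ∧ ∀ x, Z x ∈ L x ∧ X x - Z x ∈ Q x := by
  choose Z hZ using fun x => exists_add_of_isCompl (hQ.transversal x) (X x)
  have hdec : ∀ x, Z x ∈ L x ∧ X x - Z x ∈ Q x := fun x => by
    obtain ⟨h1, b, hb, h2⟩ := hZ x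
    refine ⟨h1, ?_⟩
    rw [← h2, add_sub_cancel_left]
    exact hb
  refine ⟨Z, fun q hq => ?_, hdec⟩
  obtain ⟨V, hqV, y, e, h⟩ := exists_isAdaptedFrame hM hQ q
  have hsum : SmoothFieldOn (fun x => ∑ a : Fin k × Fin n,
      evalForm (Ω a.1) (y a.2) X x • e a.1 a.2 x) (V ∩ U) :=
    SmoothFieldOn.sum fun a _ => SmoothFieldOn.smul
      ((hM.form a.1).contMDiffOn_evalForm ((h.smooth_y a.2).mono inter_subset_left)
        (hX.mono inter_subset_right)) ((h.smooth_e a.1 a.2).mono inter_subset_left)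
  refine ((ContMDiffOn.contMDiffAt hsum ((h.isOpen.inter hU).mem_nhds
    ⟨hqV, hq⟩)).congr_of_eventuallyEq ?_).contMDiffWithinAt
  filter_upwards [h.isOpen.mem_nhds hqV] with x hx
  congr 1
  rw [← h.sum_smul_eq hM hQ hx (hdec x).1]
  refine Finset.sum_congr rfl fun a _ => ?_
  have := hQ.isotropic a.1 x _ (h.y_mem hx a.2) _ (hdec x).2
  rw [map_sub, sub_eq_zero] at this
  rw [evalForm, this]

include hφ in
/-- A vector field that is constant in a flat chart splits into parallel components along `L` and
`Q`. Hence if it lies in `L`, or in `Q`, at one point of the chart, then it does so everywhere. -/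
theorem constField_mem (hM : IsKSymplectic n k Ω L) (hQ : IsAdmissible n Ω L Q)
    (hcov : IsCanonicalConnection Ω L Q cov) (hconv : Convex ℝ φ.target)
    (hflat : ∀ c, ∀ q ∈ φ.source, cov (chartField φ fun _ => c) q = 0) (c : E)
    {p q : M} (hp : p ∈ φ.source) (hq : q ∈ φ.source) :
    (chartField φ (fun _ => c) p ∈ L p → chartField φ (fun _ => c) q ∈ L q) ∧
      (chartField φ (fun _ => c) p ∈ Q p → chartField φ (fun _ => c) q ∈ Q q) := by
  set X : VField 𝓘(ℝ, E) M := chartField φ fun _ => c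
  have hX : SmoothFieldOn X φ.source := smoothFieldOn_constField hφ c
  obtain ⟨Z, hZ, hdec⟩ := exists_smooth_decomposition hM hQ hX φ.open_source
  have hXZ := hX.sub hZ
  have hpar : ∀ z ∈ φ.source, cov Z z = 0 ∧ cov (X - Z) z = 0 := by
    intro z hz
    have hadd : cov X z = cov Z z + cov (X - Z) z := by
      rw [← cov.isCovariantDerivativeOnUniv.add (hZ.mdifferentiableAt φ.open_source hz)
        (hXZ.mdifferentiableAt φ.open_source hz), add_sub_cancel]
    have h0 : ∀ u, cov Z z u + cov (X - Z) z u = 0 := fun u => by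
      rw [← _root_.add_apply, ← hadd, hflat c z hz]; rfl
    have hL : ∀ u, cov Z z u ∈ L z := (preserves_leaves hM hQ hcov).cov_mem φ.open_source hZ
      (fun x _ => (hdec x).1) hz
    have hQ' : ∀ u, cov (X - Z) z u ∈ Q z := hcov.preserves_transversal.cov_mem φ.open_source hXZ
      (fun x _ => (hdec x).2) hz
    -- the two components of `∇X = 0` lie in the complementary `L` and `Q`
    have h1 : ∀ u, cov Z z u = 0 := fun u => by
      refine Submodule.disjoint_def.1 (hQ.transversal z).disjoint _ (hL u) ?_
      rw [eq_neg_of_add_eq_zero_left (h0 u)]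
      exact Submodule.neg_mem _ (hQ' u)
    refine ⟨ContinuousLinearMap.ext h1, ContinuousLinearMap.ext fun u => ?_⟩
    have := h0 u
    rwa [h1, zero_add] at this
  constructor
  · intro h
    have h0 : (X - Z) p = 0 := Submodule.disjoint_def.1 (hQ.transversal p).disjoint _
      (Submodule.sub_mem _ h (hdec p).1) (hdec p).2
    have h1 := eq_zero_of_parallel hφ hM hcov.parallel hconv hflat hXZ (fun z hz => (hpar z hz).2)
      hp h0 hq
    rw [show X q = Z q from sub_eq_zero.1 h1]
    exact (hdec q).1
  · intro h
    have h0 : Z p = 0 := by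
      refine Submodule.disjoint_def.1 (hQ.transversal p).disjoint _ (hdec p).1 ?_
      have := Submodule.sub_mem _ h (hdec p).2
      rwa [sub_sub_cancel] at this
    have h1 := eq_zero_of_parallel hφ hM hcov.parallel hconv hflat hZ (fun z hz => (hpar z hz).1)
      hp h0 hq
    have := (hdec q).2
    rwa [h1, sub_zero] at this

end FlatCharts

/-! ### Darboux charts -/

section Darboux

theorem bijective_sumElim_xIdx_yIdx (n k : ℕ) : Function.Bijective
    (Sum.elim (xIdx k) (fun a => yIdx a.1 a.2) : Fin n ⊕ Fin k × Fin n → Fin (n * (k + 1))) := by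
  rw [Fintype.bijective_iff_injective_and_card]
  constructor
  · rintro (i | ⟨α, i⟩) (j | ⟨β, j⟩) h
    · simp only [Sum.elim_inl, xIdx, Fin.mk.injEq] at h
      rw [Fin.ext h]
    · simp only [Sum.elim_inl, Sum.elim_inr, xIdx, yIdx, Fin.mk.injEq] at h
      have := i.2
      omega
    · simp only [Sum.elim_inl, Sum.elim_inr, xIdx, yIdx, Fin.mk.injEq] at h
      have := j.2
      omega
    · simp only [Sum.elim_inr, yIdx, Fin.mk.injEq, add_right_inj] at h
      have h1 : ((α : ℕ) * n + i) / n = (β * n + j) / n := by rw [h]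
      have h2 : ((α : ℕ) * n + i) % n = (β * n + j) % n := by rw [h]
      rw [Nat.add_div_of_dvd_right (Dvd.intro_left _ rfl), Nat.add_div_of_dvd_right
        (Dvd.intro_left _ rfl), Nat.div_eq_of_lt i.2, Nat.div_eq_of_lt j.2,
        Nat.mul_div_cancel _ i.pos, Nat.mul_div_cancel _ i.pos] at h1
      rw [Nat.mul_add_mod', Nat.mul_add_mod', Nat.mod_eq_of_lt i.2, Nat.mod_eq_of_lt j.2] at h2
      rw [Fin.ext h1, Fin.ext h2]
  · simp [mul_add, mul_comm, add_comm]

/-- The positions of the coordinates `x_i` and `y_{(α-1)n+i}` among all coordinates. -/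
def idxEquiv (n k : ℕ) : Fin n ⊕ Fin k × Fin n ≃ Fin (n * (k + 1)) :=
  Equiv.ofBijective _ (bijective_sumElim_xIdx_yIdx n k)

variable {n k : ℕ} {M : Type*} [TopologicalSpace M]
    [ChartedSpace (EuclideanSpace ℝ (Fin (n * (k + 1)))) M]
    {L : Distribution (𝓡 (n * (k + 1))) M}

theorem dcoord_eq {φ : OpenPartialHomeomorph M (EuclideanSpace ℝ (Fin (n * (k + 1))))}
    (hφ : φ ∈ IsManifold.maximalAtlas (𝓡 (n * (k + 1))) ∞ M) {q : M} (hq : q ∈ φ.source)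
    (j : Fin (n * (k + 1))) (u : TangentSpace (𝓡 (n * (k + 1))) q) :
    dcoord φ j q u = chartDeriv φ q u j := by
  let l : EuclideanSpace ℝ (Fin (n * (k + 1))) →L[ℝ] ℝ := EuclideanSpace.proj j
  have := mvfderiv_comp_chart hφ hq (f := l) l.differentiableAt u
  rwa [ContinuousLinearMap.fderiv] at this

theorem chartDeriv_coordField
    {φ : OpenPartialHomeomorph M (EuclideanSpace ℝ (Fin (n * (k + 1))))}
    (hφ : φ ∈ IsManifold.maximalAtlas (𝓡 (n * (k + 1))) ∞ M) {q : M} (hq : q ∈ φ.source)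
    (j : Fin (n * (k + 1))) :
    chartDeriv φ q (coordField φ j q) = EuclideanSpace.single j 1 :=
  chartDeriv_chartField hφ hq fun _ => EuclideanSpace.single j (1 : ℝ)

/-- The expansion of a tangent vector in the coordinate frame. -/
theorem sum_dcoord_smul_coordField
    {φ : OpenPartialHomeomorph M (EuclideanSpace ℝ (Fin (n * (k + 1))))}
    (hφ : φ ∈ IsManifold.maximalAtlas (𝓡 (n * (k + 1))) ∞ M) {q : M} (hq : q ∈ φ.source)
    (u : TangentSpace (𝓡 (n * (k + 1))) q) :
    ∑ i : Fin n, dcoord φ (xIdx k i) q u • coordField φ (xIdx k i) q +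
      ∑ a : Fin k × Fin n, dcoord φ (yIdx a.1 a.2) q u • coordField φ (yIdx a.1 a.2) q = u := by
  have hinj : Function.Injective (chartDeriv φ q) := by
    obtain ⟨B, hB⟩ := isInvertible_chartDeriv hφ hq
    rw [← hB]; exact B.injective
  apply hinj
  simp only [map_add, map_sum, map_smul, chartDeriv_coordField hφ hq, dcoord_eq hφ hq]
  have h1 := (EuclideanSpace.basisFun (Fin (n * (k + 1))) ℝ).sum_repr (chartDeriv φ q u)
  rw [← (idxEquiv n k).sum_comp, Fintype.sum_sum_type] at h1
  simpa [idxEquiv] using h1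

/-- In a chart with convex image in which `L` is the common kernel of the `dx_i`, the leaves of `L`
are the level sets of `(x_1, …, x_n)`: two points of a level set are joined by a segment. -/
theorem sameLeafIn_iff {φ : OpenPartialHomeomorph M (EuclideanSpace ℝ (Fin (n * (k + 1))))}
    (hφ : φ ∈ IsManifold.maximalAtlas (𝓡 (n * (k + 1))) ∞ M) (hconv : Convex ℝ φ.target)
    (hL : ∀ q ∈ φ.source, ∀ v : TangentSpace (𝓡 (n * (k + 1))) q,
      v ∈ L q ↔ ∀ i : Fin n, dcoord φ (xIdx k i) q v = 0) {a b : M} (ha : a ∈ φ.source)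
    (hb : b ∈ φ.source) :
    SameLeafIn L φ.source a b ↔ ∀ i : Fin n, coord φ (xIdx k i) a = coord φ (xIdx k i) b := by
  constructor
  · rintro ⟨γ, hγ, rfl, rfl, hγL⟩ i
    have hd : ∀ t ∈ Icc (0 : ℝ) 1, HasDerivWithinAt (fun t => coord φ (xIdx k i) (γ t)) 0
        (Icc 0 1) t := by
      intro t ht
      have h1 := hasDerivWithinAt_comp_chart hφ ((hγ.mdifferentiableOn (by simp)) t ht)
        (hγL t ht).1
      let l : EuclideanSpace ℝ (Fin (n * (k + 1))) →L[ℝ] ℝ := EuclideanSpace.proj (xIdx k i)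
      have h2 := l.hasFDerivAt.comp_hasDerivWithinAt t h1
      have h3 := (hL _ (hγL t ht).1 _).1 (hγL t ht).2 i
      rw [dcoord_eq hφ (hγL t ht).1] at h3
      exact HasDerivWithinAt.congr_deriv h2 h3
    refine (constant_of_has_deriv_right_zero (fun t ht => (hd t ht).continuousWithinAt)
      (fun t ht => ?_) 1 (by simp)).symm
    exact (hd t ⟨ht.1, ht.2.le⟩).mono_of_mem_nhdsWithin (Icc_mem_nhdsGE_of_mem ht)
  · intro h
    let c : ℝ → EuclideanSpace ℝ (Fin (n * (k + 1))) := AffineMap.lineMap (φ a) (φ b)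
    have hc : ∀ t ∈ Icc (0 : ℝ) 1, c t ∈ φ.target := fun t ht =>
      hconv.segment_subset (φ.map_source ha) (φ.map_source hb)
        (segment_eq_image_lineMap ℝ (φ a) (φ b) ▸ mem_image_of_mem _ ht)
    have hcd : ∀ t, HasDerivAt c (φ b - φ a) t := fun t => AffineMap.hasDerivAt_lineMap
    have hcs : ContDiff ℝ ∞ c := by
      have : c = fun t => t • (φ b - φ a) + φ a := by
        funext t
        simp [c, AffineMap.lineMap_apply]
      rw [this]
      fun_prop
    have hγ : ContMDiffOn 𝓘(ℝ, ℝ) (𝓡 (n * (k + 1))) ∞ (φ.symm ∘ c) (Icc 0 1) :=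
      (contMDiffOn_symm_of_mem_maximalAtlas hφ).comp hcs.contMDiff.contMDiffOn hc
    refine ⟨φ.symm ∘ c, hγ, by simp [c, φ.left_inv ha], by simp [c, φ.left_inv hb],
      fun t ht => ⟨φ.map_target (hc t ht), ?_⟩⟩
    have hs : (φ.symm ∘ c) t ∈ φ.source := φ.map_target (hc t ht)
    have h1 := hasDerivWithinAt_comp_chart hφ ((hγ.mdifferentiableOn (by simp)) t ht) hs
    have h2 : HasDerivWithinAt (φ ∘ φ.symm ∘ c) (φ b - φ a) (Icc 0 1) t :=
      (hcd t).hasDerivWithinAt.congr_of_mem (fun z hz => φ.right_inv (hc z hz)) ht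
    have h3 := (uniqueDiffOn_Icc zero_lt_one t ht).eq_deriv _ h1 h2
    refine (hL _ hs _).2 fun i => ?_
    rw [dcoord_eq hφ hs, h3]
    exact sub_eq_zero.2 (h i).symm

variable [IsManifold (𝓡 (n * (k + 1))) ∞ M] {Ω : Fin k → BilinForm (𝓡 (n * (k + 1))) M}
    {Q : Distribution (𝓡 (n * (k + 1))) M}

/-- An adapted frame at `p` is carried to the standard basis by a linear isomorphism. -/
theorem IsAdaptedFrame.exists_equiv (hM : IsKSymplectic n k Ω L) (hQ : IsAdmissible n Ω L Q)
    {U : Set M} {y : Fin n → VField (𝓡 (n * (k + 1))) M}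
    {e : Fin k → Fin n → VField (𝓡 (n * (k + 1))) M} (h : IsAdaptedFrame Ω L Q U y e) {p : M}
    (hp : p ∈ U) : ∃ ℓ : TangentSpace (𝓡 (n * (k + 1))) p ≃L[ℝ]
      EuclideanSpace ℝ (Fin (n * (k + 1))),
      (∀ i, ℓ (y i p) = EuclideanSpace.single (xIdx k i) 1) ∧
      ∀ α i, ℓ (e α i p) = EuclideanSpace.single (yIdx α i) 1 := by
  have : FiniteDimensional ℝ (TangentSpace (𝓡 (n * (k + 1))) p) :=
    inferInstanceAs (FiniteDimensional ℝ (EuclideanSpace ℝ (Fin (n * (k + 1)))))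
  have : T2Space (TangentSpace (𝓡 (n * (k + 1))) p) :=
    inferInstanceAs (T2Space (EuclideanSpace ℝ (Fin (n * (k + 1)))))
  let v : Fin n ⊕ Fin k × Fin n → TangentSpace (𝓡 (n * (k + 1))) p :=
    Sum.elim (fun i => y i p) fun a => e a.1 a.2 p
  have hspan : ⊤ ≤ Submodule.span ℝ (range v) := by
    rw [← (hQ.transversal p).sup_eq_top]
    refine sup_le (fun u hu => ?_) ?_
    · rw [← h.sum_smul_eq hM hQ hp hu]
      exact Submodule.sum_mem _ fun a _ => Submodule.smul_mem _ _
        (Submodule.subset_span ⟨Sum.inr a, rfl⟩)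
    · rw [← h.span_y p hp]
      exact Submodule.span_mono (range_subset_iff.2 fun i => ⟨Sum.inl i, rfl⟩)
  have hcard : Fintype.card (Fin n ⊕ Fin k × Fin n) =
      Module.finrank ℝ (TangentSpace (𝓡 (n * (k + 1))) p) := by
    have : Module.finrank ℝ (TangentSpace (𝓡 (n * (k + 1))) p) = n * (k + 1) :=
      finrank_euclideanSpace_fin
    rw [this, Fintype.card_congr (idxEquiv n k), Fintype.card_fin]
  let b := basisOfTopLeSpanOfCardEqFinrank v hspan hcard
  let ℓ : TangentSpace (𝓡 (n * (k + 1))) p ≃L[ℝ] EuclideanSpace ℝ (Fin (n * (k + 1))) :=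
    (b.equiv (EuclideanSpace.basisFun (Fin (n * (k + 1))) ℝ).toBasis
      (idxEquiv n k)).toContinuousLinearEquiv
  have hℓ : ∀ a, ℓ (v a) = EuclideanSpace.single (idxEquiv n k a) 1 := by
    intro a
    have hb : b a = v a := by simp [b]
    rw [← hb]
    change b.equiv _ _ (b a) = _
    rw [Module.Basis.equiv_apply]
    simp
  exact ⟨ℓ, fun i => hℓ (Sum.inl i), fun α i => hℓ (Sum.inr (α, i))⟩

/-- In a flat chart that carries an adapted frame at one point to the coordinate frame, the
coordinate frame is adapted at every point. -/
theorem isAdaptedDarbouxChart_of_flat [T2Space M]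
    {cov : CovariantDerivative (𝓡 (n * (k + 1))) (EuclideanSpace ℝ (Fin (n * (k + 1))))
      (TangentSpace (𝓡 (n * (k + 1))) : M → Type _)}
    (hM : IsKSymplectic n k Ω L) (hQ : IsAdmissible n Ω L Q)
    (hcov : IsCanonicalConnection Ω L Q cov)
    {φ : OpenPartialHomeomorph M (EuclideanSpace ℝ (Fin (n * (k + 1))))}
    (hφ : φ ∈ IsManifold.maximalAtlas (𝓡 (n * (k + 1))) ∞ M) (hconv : Convex ℝ φ.target)
    (hflat : ∀ c, ∀ q ∈ φ.source, cov (chartField φ fun _ => c) q = 0)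
    {U : Set M} {y : Fin n → VField (𝓡 (n * (k + 1))) M}
    {e : Fin k → Fin n → VField (𝓡 (n * (k + 1))) M} (h : IsAdaptedFrame Ω L Q U y e) {p : M}
    (hpU : p ∈ U) (hp : p ∈ φ.source) (hy : ∀ i, coordField φ (xIdx k i) p = y i p)
    (he : ∀ α i, coordField φ (yIdx α i) p = e α i p) : IsAdaptedDarbouxChart Ω L Q φ := by
  have hXQ : ∀ i, ∀ q ∈ φ.source, coordField φ (xIdx k i) q ∈ Q q := fun i q hq =>
    (constField_mem hφ hM hQ hcov hconv hflat _ hp hq).2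
      (show coordField φ (xIdx k i) p ∈ Q p from hy i ▸ h.y_mem hpU i)
  have hYL : ∀ α i, ∀ q ∈ φ.source, coordField φ (yIdx α i) q ∈ L q := fun α i q hq =>
    (constField_mem hφ hM hQ hcov hconv hflat _ hp hq).1
      (show coordField φ (yIdx α i) p ∈ L p from he α i ▸ h.e_mem α i p hpU)
  have hdual : ∀ α β i j, ∀ q ∈ φ.source, Ω β q (coordField φ (xIdx k j) q)
      (coordField φ (yIdx α i) q) = if (α, i) = (β, j) then 1 else 0 := by
    intro α β i j q hq
    rw [← h.dual α β i j p hpU, ← hy, ← he]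
    exact evalForm_eq_of_parallel hφ (hM.form β) (hcov.parallel β) hconv
      (smoothFieldOn_constField hφ _) (smoothFieldOn_constField hφ _) (hflat _) (hflat _) hp hq
  have hsum : ∀ q ∈ φ.source, ∀ u : TangentSpace (𝓡 (n * (k + 1))) q, ∃ a ∈ Q q, ∃ b ∈ L q,
      a = ∑ i : Fin n, dcoord φ (xIdx k i) q u • coordField φ (xIdx k i) q ∧
      b = ∑ a : Fin k × Fin n, dcoord φ (yIdx a.1 a.2) q u • coordField φ (yIdx a.1 a.2) q ∧
      a + b = u := fun q hq u =>
    ⟨_, Submodule.sum_mem _ fun i _ => Submodule.smul_mem _ _ (hXQ i q hq), _,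
      Submodule.sum_mem _ fun a _ => Submodule.smul_mem _ _ (hYL a.1 a.2 q hq), rfl, rfl,
      sum_dcoord_smul_coordField hφ hq u⟩
  have hL : ∀ q ∈ φ.source, ∀ v : TangentSpace (𝓡 (n * (k + 1))) q,
      v ∈ L q ↔ ∀ i : Fin n, dcoord φ (xIdx k i) q v = 0 := by
    intro q hq v
    obtain ⟨a, ha, b, hb, hae, hbe, hab⟩ := hsum q hq v
    constructor
    · intro hv i
      have h0 : a = 0 := by
        refine Submodule.disjoint_def.1 (hQ.transversal q).disjoint _ ?_ ha
        rw [← hab] at hv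
        exact (Submodule.add_mem_iff_left _ hb).1 hv
      have h1 := congrArg (fun w => chartDeriv φ q w (xIdx k i)) (hae.symm.trans h0)
      simpa [chartDeriv_coordField hφ hq, Finset.sum_apply, Pi.single_apply,
        show ∀ j : Fin n, xIdx k i = xIdx k j ↔ i = j from fun j => by
          simp [xIdx, Fin.ext_iff]] using h1
    · intro h0
      have : a = 0 := by rw [hae]; exact Finset.sum_eq_zero fun i _ => by rw [h0, zero_smul]
      rw [← hab, this, zero_add]
      exact hb
  refine ⟨fun α q hq u v => ?_, hL, fun a ha b hb => sameLeafIn_iff hφ hconv hL ha hb,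
    fun q hq => le_antisymm (fun v hv => ?_) ?_⟩
  · obtain ⟨a, ha, b, hb, hae, hbe, hab⟩ := hsum q hq u
    obtain ⟨a', ha', b', hb', hae', hbe', hab'⟩ := hsum q hq v
    have key : ∀ s : Fin n → ℝ, ∀ t : Fin k × Fin n → ℝ,
        Ω α q (∑ i, s i • coordField φ (xIdx k i) q)
          (∑ a, t a • coordField φ (yIdx a.1 a.2) q) = ∑ i, s i * t (α, i) := by
      intro s t
      simp only [map_sum, map_smul, _root_.sum_apply, _root_.smul_apply,
        hdual _ _ _ _ q hq, smul_eq_mul, Finset.mul_sum]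
      rw [Finset.sum_comm]
      simp [-Prod.mk.injEq, mul_comm]
    have huv : Ω α q u v = Ω α q (a + b) (a' + b') := by rw [hab, hab']
    rw [huv]
    simp only [map_add, _root_.add_apply]
    rw [hQ.isotropic α q a ha a' ha', hM.isotropic α q b hb b' hb',
      (hM.form α).neg_swap b a']
    conv_lhs => rw [hae, hbe, hae', hbe']
    rw [key, key, zero_add, add_zero, ← sub_eq_neg_add, ← Finset.sum_sub_distrib]
    rfl
  · obtain ⟨a, ha, b, hb, hae, hbe, hab⟩ := hsum q hq v
    have h0 : b = 0 := by
      refine Submodule.disjoint_def.1 (hQ.transversal q).disjoint _ hb ?_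
      rw [← hab] at hv
      exact (Submodule.add_mem_iff_right _ ha).1 hv
    rw [← hab, h0, add_zero, hae]
    exact Submodule.sum_mem _ fun i _ => Submodule.smul_mem _ _
      (Submodule.subset_span (mem_range_self i))
  · rw [Submodule.span_le]
    rintro _ ⟨i, rfl⟩
    exact hXQ i q hq

end Darboux

end KSymplectic

end

theorem mainTheorem3 (n k : ℕ) {M : Type*} [TopologicalSpace M] [T2Space M]
    [ChartedSpace (EuclideanSpace ℝ (Fin (n * (k + 1)))) M]
    [IsManifold (𝓡 (n * (k + 1))) ∞ M]
    (Ω : Fin k → KSymplectic.BilinForm (𝓡 (n * (k + 1))) M)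
    (L Q : KSymplectic.Distribution (𝓡 (n * (k + 1))) M)
    (hM : KSymplectic.IsKSymplectic n k Ω L)
    (hQ : KSymplectic.IsAdmissible n Ω L Q)
    (cov : CovariantDerivative (𝓡 (n * (k + 1))) (EuclideanSpace ℝ (Fin (n * (k + 1))))
      (TangentSpace (𝓡 (n * (k + 1))) : M → Type _))
    (hcov : KSymplectic.IsCanonicalConnection Ω L Q cov)
    (hflat : KSymplectic.IsFlat cov) (p : M) :
    ∃ φ ∈ IsManifold.maximalAtlas (𝓡 (n * (k + 1))) ∞ M,
      p ∈ φ.source ∧ KSymplectic.IsAdaptedDarbouxChart Ω L Q φ := by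
  obtain ⟨U, hpU, y, e, h⟩ := KSymplectic.exists_isAdaptedFrame hM hQ p
  obtain ⟨ℓ, hy, he⟩ := h.exists_equiv hM hQ hpU
  obtain ⟨φ, hφ, hp, hconv, hℓ, hpar⟩ := KSymplectic.exists_flat_chart hcov.smooth hflat
    (KSymplectic.torsion_eq_zero hM hQ hcov) p ℓ
  have hcoord : ∀ j u, ℓ u = EuclideanSpace.single j 1 → KSymplectic.coordField φ j p = u := by
    intro j u hu
    apply ℓ.injective
    rw [hu, ← KSymplectic.chartDeriv_coordField hφ hp j, hℓ]
    rfl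
  exact ⟨φ, hφ, hp, KSymplectic.isAdaptedDarbouxChart_of_flat hM hQ hcov hφ hconv hpar h hpU hp
    (fun i => hcoord _ _ (hy i)) fun α i => hcoord _ _ (he α i)⟩
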